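/- **Conventions.** A tournament is a finite loopless digraph in which any two distinct vertices are joined by exactly one arc; $u\to v$ means that $u$ beats $v$, and $\mathrm{Tr}_3$ is the transitive tournament on three vertices. Let $A$ be the type on two labelled vertices $1,2$ with $1\to 2$. An $A$-flag is a tournament together with an ordered pair of vertices labelled $1,2$ with $1\to 2$; flags are considered up to label-preserving isomorphism. $\mathrm{Tr}_3^A$ is the $A$-flag on $\mathrm{Tr}_3$ in which the winner is labelled $1$ and the loser is labelled $2$, so its unlabelled vertex $w$ satisfies $1\to w\to 2$. $\mathcal A^0$ and $\mathcal A^A$ are Razborov's flag algebras of tournaments, of unlabelled tournaments and of $A$-flags, respectively; $\mathbb 1_A$ is the unity of $\mathcal A^A$, and $\mathrm{Hom}^+(\mathcal A^\sigma,\mathbb R)$ is the set of algebra homomorphisms that are nonnegative on all $\sigma$-flags ("limit objects"). For $\phi\in\mathrm{Hom}^+(\mathcal A^0,\mathbb R)$, the extension $\boldsymbol{\phi}^A$ is the $\mathrm{Hom}^+(\mathcal A^A,\mathbb R)$-valued random variable with $$\mathbb E[\boldsymbol{\phi}^A(F)]=\frac{\phi([\![F]\!]_A)}{\phi([\![\mathbb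 1_A]\!]_A)}\quad\text{for every $A$-flag }F,$$ where $[\![F]\!]_A$ is the unlabelled tournament underlying $F$ times the probability that a uniformly random injective placement of the labels $1,2$ on it yields a flag isomorphic to $F$. Finally, $\phi_{\mathrm{rdm}}\in\mathrm{Hom}^+(\mathcal A^0,\mathbb R)$ is the limit of the random tournaments: $\phi_{\mathrm{rdm}}(T)$ is the probability that a uniformly random tournament on $|V(T)|$ vertices is isomorphic to $T$, that is, $|V(T)|!\,/\,\bigl(|\mathrm{Aut}(T)|\,2^{\binom{|V(T)|}{2}}\bigr)$. **Theorem.** (i) For every $\phi\in\mathrm{Hom}^+(\mathcal A^0,\mathbb R)$, the extension $\boldsymbol{\phi}^A$ exists, and $$\boldsymbol{\phi}^A(\mathrm{Tr}_3^A)=\tfrac14\ \text{ almost surely}\quad\Longleftrightarrow\quad \phi=\phi_{\mathrm{rdm}}.$$ (ii) Let $(T_i)$ be a sequence of tournaments whose numbers of vertices $n_i$ tend to infinity, and for an arc $u\to v$ of $T_i$ put $\mathrm{Tr}_3^A(u,v)=|\{w: u\to w\to v\}|/(n_i-2)$. Then $(T_i)$ is quasi-random (that is, for every fixed tournament $H$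 the density with which $H$ occurs as an induced sub-tournament of $T_i$ tends to $\phi_{\mathrm{rdm}}(H)$) if and only if $$\sum_{u\to v\text{ in }T_i}\bigl|\mathrm{Tr}_3^A(u,v)-\tfrac14\bigr| = o(n_i^2).$$ -/

import Mathlib

open Finset Filter Asymptotics MeasureTheory
open scoped Classical Topology

/-- A tournament on `V`: a loopless digraph in which every two distinct vertices are joined by
exactly one arc. `T.Adj u v` means that `u` beats `v`, i.e. that `u → v` is an arc. -/
@[ext]
structure Tournament (V : Type*) extends Digraph V where
  irrefl : ∀ x, ¬ Adj x x
  adj_iff : ∀ x y, x ≠ y → (Adj x y ↔ ¬ Adj y x)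

/-- The sub-tournament pulled back along an injective map of vertices. -/
def Tournament.comap {V W : Type*} (T : Tournament W) (f : V ↪ W) : Tournament V where
  Adj u v := T.Adj (f u) (f v)
  irrefl _ := T.irrefl _
  adj_iff _ _ h := T.adj_iff _ _ (fun h' => h (f.injective h'))

instance {V : Type*} [Finite V] : Finite (Tournament V) :=
  Finite.of_injective (fun T : Tournament V => T.Adj) (fun _ _ h => Tournament.ext h)

noncomputable instance {V : Type*} [Finite V] : Fintype (Tournament V) := Fintype.ofFinite _

/-- The transitive tournament `Tr_n`: `i` beats `j` exactly when `i < j`. -/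
def transTournament (n : ℕ) : Tournament (Fin n) where
  Adj i j := i < j
  irrefl i := lt_irrefl i
  adj_iff i j h := by rw [not_lt]; exact ⟨le_of_lt, fun h' => lt_of_le_of_ne h' h⟩

/-- The empty type `0`. -/
def emptyType : Tournament (Fin 0) := transTournament 0

/-- The type `A` of size two, in which the first labelled vertex beats the second one. -/
def arcType : Tournament (Fin 2) := transTournament 2

/-- A `σ`-flag with vertex set `V`: a tournament on `V` together with an embedding of the type `σ`
into it (a partial labelling of the vertices). -/
structure TFlag {k : ℕ} (σ : Tournament (Fin k)) (V : Type*) where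
  model : Tournament V
  label : Fin k ↪ V
  label_adj : ∀ i j, model.Adj (label i) (label j) ↔ σ.Adj i j

namespace TFlag

variable {k : ℕ} {σ : Tournament (Fin k)} {U V W : Type*}

/-- Isomorphism of `σ`-flags: an isomorphism of tournaments that preserves the labels. -/
def Iso (F : TFlag σ V) (G : TFlag σ W) : Prop :=
  ∃ e : V ≃ W, (∀ u v, G.model.Adj (e u) (e v) ↔ F.model.Adj u v) ∧
    ∀ i, e (F.label i) = G.label i

theorem Iso.refl (F : TFlag σ V) : F.Iso F := ⟨Equiv.refl V, fun _ _ => Iff.rfl, fun _ => rfl⟩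

theorem Iso.symm {F : TFlag σ V} {G : TFlag σ W} : F.Iso G → G.Iso F := by
  rintro ⟨e, he, hl⟩
  refine ⟨e.symm, fun u v => ?_, fun i => ?_⟩
  · rw [← he]; simp
  · rw [← hl]; simp

theorem Iso.trans {F : TFlag σ U} {G : TFlag σ V} {H : TFlag σ W} :
    F.Iso G → G.Iso H → F.Iso H := by
  rintro ⟨e, he, hl⟩ ⟨e', he', hl'⟩
  refine ⟨e.trans e', fun u v => ?_, fun i => ?_⟩
  · rw [← he, ← he']; simp
  · rw [← hl', ← hl]; simp

instance [Finite V] : Finite (TFlag σ V) :=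
  Finite.of_injective (fun F : TFlag σ V => (F.model, F.label)) (by
    rintro ⟨m, l, h⟩ ⟨m', l', h'⟩ h0
    simp only [Prod.mk.injEq] at h0
    obtain ⟨rfl, rfl⟩ := h0
    rfl)

instance setoid (σ : Tournament (Fin k)) (n : ℕ) : Setoid (TFlag σ (Fin n)) where
  r F G := F.Iso G
  iseqv := ⟨Iso.refl, Iso.symm, Iso.trans⟩

/-- The `0`-flag given by a tournament. -/
def ofTournament (T : Tournament V) : TFlag emptyType V where
  model := T
  label := ⟨fun i => i.elim0, fun i => i.elim0⟩
  label_adj i := i.elim0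

/-- The flag `1_σ`: the type `σ` itself, fully labelled. -/
def unit (σ : Tournament (Fin k)) : TFlag σ (Fin k) where
  model := σ
  label := Function.Embedding.refl _
  label_adj _ _ := Iff.rfl

/-- The set of labelled vertices. -/
def labels (F : TFlag σ V) : Finset V := univ.map F.label

/-- The sub-flag induced on a set of vertices that contains all labelled vertices. -/
def induce (F : TFlag σ V) (S : Finset V) (h : F.labels ⊆ S) : TFlag σ S where
  model := F.model.comap (Function.Embedding.subtype _)
  label := ⟨fun i => ⟨F.label i, h (mem_map_of_mem _ (mem_univ i))⟩,
    fun _ _ hij => F.label.injective (congrArg Subtype.val hij)⟩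
  label_adj i j := F.label_adj i j

/-- `S` contains the labelled vertices of `F` and induces in `F` a copy of the flag `F₁`. -/
def Induces (F : TFlag σ V) (S : Finset V) (F₁ : TFlag σ W) : Prop :=
  ∃ h : F.labels ⊆ S, (F.induce S h).Iso F₁

/-- The sets of `m` vertices of `F` that contain the labelled vertices. -/
noncomputable def extSets [Fintype V] (F : TFlag σ V) (m : ℕ) : Finset (Finset V) :=
  {S | F.labels ⊆ S ∧ #S = m}

/-- The pairs of vertex sets of sizes `m₁`, `m₂` that contain the labelled vertices of `F` and are
disjoint otherwise. -/
noncomputable def extPairs [Fintype V] (F : TFlag σ V) (m₁ m₂ : ℕ) :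
    Finset (Finset V × Finset V) :=
  {S | S.1 ∩ S.2 = F.labels ∧ #S.1 = m₁ ∧ #S.2 = m₂}

/-- The density `p(F₁, F)`: the probability that a uniformly random set of `|F₁|` vertices of `F`
containing the labelled ones induces a copy of `F₁`. -/
noncomputable def density {m : ℕ} [Fintype V] (F₁ : TFlag σ (Fin m)) (F : TFlag σ V) : ℝ :=
  (#{S ∈ F.extSets m | F.Induces S F₁} : ℝ) / #(F.extSets m)

/-- The joint density `p(F₁, F₂; F)`: the probability that a uniformly random pair of vertex sets
of sizes `|F₁|`, `|F₂|` meeting exactly in the labelled vertices induces copies of `F₁`, `F₂`. -/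
noncomputable def pairDensity {m₁ m₂ : ℕ} [Fintype V] (F₁ : TFlag σ (Fin m₁))
    (F₂ : TFlag σ (Fin m₂)) (F : TFlag σ V) : ℝ :=
  (#{S ∈ F.extPairs m₁ m₂ | F.Induces S.1 F₁ ∧ F.Induces S.2 F₂} : ℝ) / #(F.extPairs m₁ m₂)

/-- The normalizing factor `q_σ(F)` of the downward operator: the probability that a uniformly
random injection of the labels into the vertices of the unlabelled model of `F` yields a flag
isomorphic to `F`. -/
noncomputable def labelProb {n : ℕ} (F : TFlag σ (Fin n)) : ℝ :=
  (#{θ : Fin k ↪ Fin n | ∃ h, TFlag.Iso (⟨F.model, θ, h⟩ : TFlag σ (Fin n)) F} : ℝ) /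
    Fintype.card (Fin k ↪ Fin n)

end TFlag

/-- The set `F_n^σ` of isomorphism classes of `σ`-flags with `n` vertices. -/
abbrev FlagClass {k : ℕ} (σ : Tournament (Fin k)) (n : ℕ) := Quotient (TFlag.setoid σ n)

noncomputable instance {k : ℕ} (σ : Tournament (Fin k)) (n : ℕ) : Fintype (FlagClass σ n) :=
  Fintype.ofFinite _

/-- `Hom⁺(A^σ, ℝ)`. The algebra `A^σ` is the real vector space with basis the isomorphism classes
of `σ`-flags, modulo the relations `F₁ = ∑_{F ∈ F_ℓ} p(F₁, F) F` for `ℓ ≥ |F₁|`, with product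
`F₁ F₂ = ∑_{F ∈ F_ℓ} p(F₁, F₂; F) F` for `ℓ = |F₁| + |F₂| - |σ|` and unity `1_σ`. A homomorphism
from it to `ℝ` is thus given by its values on flags, subject to the conditions `chain`, `mul` and
`one`; it is positive if these values are nonnegative. -/
@[ext]
structure PosHom {k : ℕ} (σ : Tournament (Fin k)) where
  val : ∀ n, FlagClass σ n → ℝ
  nonneg : ∀ n F, 0 ≤ val n F
  one : val k ⟦TFlag.unit σ⟧ = 1
  chain : ∀ m ℓ (F₁ : TFlag σ (Fin m)), m ≤ ℓ →
    val m ⟦F₁⟧ = ∑ F : FlagClass σ ℓ, F₁.density F.out * val ℓ F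
  mul : ∀ m₁ m₂ ℓ (F₁ : TFlag σ (Fin m₁)) (F₂ : TFlag σ (Fin m₂)), ℓ + k = m₁ + m₂ →
    val m₁ ⟦F₁⟧ * val m₂ ⟦F₂⟧ = ∑ F : FlagClass σ ℓ, F₁.pairDensity F₂ F.out * val ℓ F

/-- The value of a positive homomorphism on a flag. -/
def PosHom.eval {k n : ℕ} {σ : Tournament (Fin k)} (ψ : PosHom σ) (F : TFlag σ (Fin n)) : ℝ :=
  ψ.val n ⟦F⟧

/-- The `σ`-algebra on `Hom⁺(A^σ, ℝ)` generated by the evaluations at flags (the Borel sets of the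
topology of pointwise convergence, as there are countably many flags). -/
instance {k : ℕ} (σ : Tournament (Fin k)) : MeasurableSpace (PosHom σ) :=
  MeasurableSpace.comap PosHom.val MeasurableSpace.pi

/-- `φ(⟦F⟧_σ)`, where `⟦F⟧_σ = q_σ(F) · F|₀` is the image of `F` under the downward operator. -/
noncomputable def PosHom.evalDown {k n : ℕ} {σ : Tournament (Fin k)} (φ : PosHom emptyType)
    (F : TFlag σ (Fin n)) : ℝ :=
  F.labelProb * φ.eval (TFlag.ofTournament F.model)

/-- `P` is the law of the random extension `φ^σ`, a random element of `Hom⁺(A^σ, ℝ)` with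
`E[φ^σ(F)] = φ(⟦F⟧_σ) / φ(⟦1_σ⟧_σ)` for every `σ`-flag `F`. -/
def IsExtension {k : ℕ} {σ : Tournament (Fin k)} (φ : PosHom emptyType)
    (P : ProbabilityMeasure (PosHom σ)) : Prop :=
  ∀ (n : ℕ) (F : TFlag σ (Fin n)),
    ∫ ψ, ψ.eval F ∂(P : Measure (PosHom σ)) = φ.evalDown F / φ.evalDown (TFlag.unit σ)

/-- The `A`-flag `Tr_3^A`: in the transitive tournament of order three, the winner has label `1`
and the loser has label `2`. -/
def trA : TFlag arcType (Fin 3) where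
  model := transTournament 3
  label := ⟨![0, 2], by decide⟩
  label_adj i j := by
    show (![0, 2] i : Fin 3) < ![0, 2] j ↔ i < j
    revert i j; decide

/-- The tournament obtained from `T` by putting a copy of `A` on the image of `f`. -/
def Tournament.replace {V W : Type*} (T : Tournament V) (f : W ↪ V) (A : Tournament W) :
    Tournament V where
  Adj u v := (∃ i j, f i = u ∧ f j = v ∧ A.Adj i j) ∨
    (¬ ((∃ i, f i = u) ∧ ∃ j, f j = v) ∧ T.Adj u v)
  irrefl u := by
    rintro (⟨i, j, rfl, h, hA⟩ | ⟨-, h⟩)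
    · obtain rfl := f.injective h
      exact A.irrefl _ hA
    · exact T.irrefl _ h
  adj_iff u v huv := by
    by_cases h : (∃ i, f i = u) ∧ ∃ j, f j = v
    · obtain ⟨⟨i, rfl⟩, j, rfl⟩ := h
      have hij : i ≠ j := fun h => huv (by rw [h])
      simpa using A.adj_iff i j hij
    · have h' : ¬ ((∃ i, f i = v) ∧ ∃ j, f j = u) := fun h' => h h'.symm
      have h1 : ¬ ∃ i j, f i = u ∧ f j = v ∧ A.Adj i j :=
        fun ⟨i, j, hi, hj, _⟩ => h ⟨⟨i, hi⟩, j, hj⟩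
      have h2 : ¬ ∃ i j, f i = v ∧ f j = u ∧ A.Adj i j :=
        fun ⟨i, j, hi, hj, _⟩ => h' ⟨⟨i, hi⟩, j, hj⟩
      simp only [h, h', h1, h2, false_or, not_false_eq_true, true_and]
      exact T.adj_iff u v huv

theorem Tournament.comap_replace {V W : Type*} (T : Tournament V) (f : W ↪ V)
    (A : Tournament W) : (T.replace f A).comap f = A := by
  ext i j
  simp [Tournament.replace, Tournament.comap]

theorem Tournament.comap_replace_of_disjoint {V W W' : Type*} (T : Tournament V) (f : W ↪ V)
    (A : Tournament W) (g : W' ↪ V) (h : ∀ i j, f i ≠ g j) :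
    (T.replace f A).comap g = T.comap g := by
  ext i j
  simp [Tournament.replace, Tournament.comap, h]

theorem Tournament.replace_replace {V W : Type*} (T : Tournament V) (f : W ↪ V)
    (A : Tournament W) : (T.replace f A).replace f (T.comap f) = T := by
  ext u v
  by_cases h : (∃ i, f i = u) ∧ ∃ j, f j = v
  · obtain ⟨⟨i, rfl⟩, j, rfl⟩ := h
    simp [Tournament.replace, Tournament.comap]
  · have h1 : ∀ B : Tournament W, ¬ ∃ i j, f i = u ∧ f j = v ∧ B.Adj i j :=
      fun B ⟨i, j, hi, hj, _⟩ => h ⟨⟨i, hi⟩, j, hj⟩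
    simp only [Tournament.replace, h1, h, false_or, not_false_eq_true, true_and]

/-- In a random tournament, the sub-tournament on the image of `f` is uniformly distributed and
independent of the remaining arcs. -/
theorem Tournament.card_comap {V W : Type*} [Finite V] [Finite W] (f : W ↪ V)
    (p : Tournament W → Prop) (q : Tournament V → Prop)
    (hq : ∀ T A, q (T.replace f A) ↔ q T) :
    Fintype.card (Tournament W) * #{T : Tournament V | p (T.comap f) ∧ q T} =
      #{A : Tournament W | p A} * #{T : Tournament V | q T} := by
  rw [← card_univ, ← card_product, ← card_product]
  refine card_nbij' (fun x => (x.2.comap f, x.2.replace f x.1))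
    (fun x => (x.2.comap f, x.2.replace f x.1)) ?_ ?_ ?_ ?_
  · rintro ⟨A, T⟩ h
    simp at h
    simp [hq, h]
  · rintro ⟨A, T⟩ h
    simp at h
    simp [hq, h, Tournament.comap_replace]
  · rintro ⟨A, T⟩ h
    simp [Tournament.comap_replace, Tournament.replace_replace]
  · rintro ⟨A, T⟩ h
    simp [Tournament.comap_replace, Tournament.replace_replace]

instance {V : Type*} [Finite V] : Nonempty (Tournament V) := by
  obtain ⟨n, ⟨e⟩⟩ := Finite.exists_equiv_fin V
  exact ⟨(transTournament n).comap e.toEmbedding⟩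

namespace TFlag

variable {k : ℕ} {σ : Tournament (Fin k)} {V W U : Type*}

theorem ofTournament_model (F : TFlag emptyType V) : ofTournament F.model = F := by
  cases F
  simp only [ofTournament, TFlag.mk.injEq, true_and]
  exact Subsingleton.elim _ _

theorem labels_empty (F : TFlag emptyType V) : F.labels = ∅ := rfl

theorem labels_map {F : TFlag σ V} {G : TFlag σ W} (e : V ≃ W)
    (hl : ∀ i, e (F.label i) = G.label i) : F.labels.map e.toEmbedding = G.labels := by
  have h : F.label.trans e.toEmbedding = G.label := DFunLike.ext _ _ hl
  simp only [labels, Finset.map_map, h]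

theorem induces_map {F : TFlag σ V} {G : TFlag σ W} (e : V ≃ W)
    (he : ∀ u v, G.model.Adj (e u) (e v) ↔ F.model.Adj u v)
    (hl : ∀ i, e (F.label i) = G.label i) (S : Finset V) (F₁ : TFlag σ U) :
    G.Induces (S.map e.toEmbedding) F₁ ↔ F.Induces S F₁ := by
  have key : ∀ (h : F.labels ⊆ S) (h' : G.labels ⊆ S.map e.toEmbedding),
      (F.induce S h).Iso (G.induce _ h') := by
    intro h h'
    refine ⟨e.subtypeEquiv (fun a => by simp), fun u v => ?_, fun i => ?_⟩
    · exact he _ _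
    · exact Subtype.ext (hl i)
  have hs : G.labels ⊆ S.map e.toEmbedding ↔ F.labels ⊆ S := by
    rw [← labels_map e hl, map_subset_map]
  constructor
  · rintro ⟨h, hi⟩
    exact ⟨hs.1 h, (key _ _).trans hi⟩
  · rintro ⟨h, hi⟩
    exact ⟨hs.2 h, (key _ _).symm.trans hi⟩

/-- Densities depend only on the isomorphism class of the big flag. -/
theorem density_congr {m : ℕ} [Fintype V] [Fintype W] (F₁ : TFlag σ (Fin m)) {F : TFlag σ V}
    {G : TFlag σ W} (h : F.Iso G) : F₁.density F = F₁.density G := by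
  obtain ⟨e, he, hl⟩ := h
  have h1 : ∀ S : Finset V, S ∈ F.extSets m ↔ S.map e.toEmbedding ∈ G.extSets m := by
    intro S
    simp [extSets, ← labels_map e hl]
  unfold density
  congr 2
  · refine card_equiv e.finsetCongr fun S => ?_
    simp only [mem_filter, Equiv.finsetCongr_apply, ← h1, induces_map e he hl]
  · exact card_equiv e.finsetCongr h1

theorem pairDensity_congr {m₁ m₂ : ℕ} [Fintype V] [Fintype W] (F₁ : TFlag σ (Fin m₁))
    (F₂ : TFlag σ (Fin m₂)) {F : TFlag σ V} {G : TFlag σ W} (h : F.Iso G) :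
    F₁.pairDensity F₂ F = F₁.pairDensity F₂ G := by
  obtain ⟨e, he, hl⟩ := h
  have h1 : ∀ S : Finset V × Finset V, S ∈ F.extPairs m₁ m₂ ↔
      (e.finsetCongr.prodCongr e.finsetCongr) S ∈ G.extPairs m₁ m₂ := by
    intro S
    simp [extPairs, ← labels_map e hl, ← map_inter]
  unfold pairDensity
  congr 2
  · refine card_equiv (e.finsetCongr.prodCongr e.finsetCongr) fun S => ?_
    simp only [mem_filter, h1]
    simp only [Equiv.prodCongr_apply, Prod.map, Equiv.finsetCongr_apply, induces_map e he hl]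
  · exact card_equiv (e.finsetCongr.prodCongr e.finsetCongr) h1

theorem induces_iff_comap {m : ℕ} (T : Tournament V) (F₁ : TFlag emptyType (Fin m))
    {S : Finset V} (e : Fin m ≃ S) :
    (ofTournament T).Induces S F₁ ↔
      (ofTournament (T.comap (e.toEmbedding.trans (Function.Embedding.subtype _)))).Iso F₁ := by
  have h : (ofTournament T).labels ⊆ S := by simp [labels_empty]
  have key : (ofTournament (T.comap (e.toEmbedding.trans (Function.Embedding.subtype _)))).Iso
      ((ofTournament T).induce S h) :=
    ⟨e, fun u v => Iff.rfl, fun i => i.elim0⟩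
  exact ⟨fun ⟨_, hi⟩ => key.trans hi, fun hi => ⟨h, key.symm.trans hi⟩⟩

end TFlag

/-- The probability that a uniformly random tournament on `n` vertices (all arcs oriented
independently, with probability `1/2` each way) is isomorphic to `T`. It equals
`n! / (|Aut T| 2 ^ (n choose 2))`. -/
noncomputable def rdmDensity {n : ℕ} (T : TFlag emptyType (Fin n)) : ℝ :=
  (#{R : Tournament (Fin n) | (TFlag.ofTournament R).Iso T} : ℝ) /
    Fintype.card (Tournament (Fin n))

theorem rdmDensity_congr {n : ℕ} (F G : TFlag emptyType (Fin n)) (h : F.Iso G) :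
    rdmDensity F = rdmDensity G := by
  unfold rdmDensity
  congr! 4
  exact ⟨fun h' => h'.trans h, fun h' => h'.trans h.symm⟩

theorem sum_mul_rdmDensity {n : ℕ} (g : TFlag emptyType (Fin n) → ℝ)
    (hg : ∀ F G, F.Iso G → g F = g G) :
    ∑ F : FlagClass emptyType n, g F.out * Quotient.lift rdmDensity rdmDensity_congr F =
      (∑ R : Tournament (Fin n), g (TFlag.ofTournament R)) / Fintype.card (Tournament (Fin n)) := by
  rw [← sum_fiberwise_of_maps_to (s := univ) (t := univ)
    (g := fun R : Tournament (Fin n) => (⟦TFlag.ofTournament R⟧ : FlagClass emptyType n))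
    (fun _ _ => mem_univ _), sum_div]
  refine sum_congr rfl fun F _ => ?_
  obtain ⟨F, rfl⟩ := Quotient.exists_rep F
  have h1 : g (Quotient.out (⟦F⟧ : FlagClass emptyType n)) = g F := hg _ _ (Quotient.mk_out F)
  have h2 : ∀ R : Tournament (Fin n), (⟦TFlag.ofTournament R⟧ : FlagClass emptyType n) = ⟦F⟧ ↔
      (TFlag.ofTournament R).Iso F := fun R => Quotient.eq
  rw [h1, Quotient.lift_mk, rdmDensity]
  simp only [h2]
  rw [sum_congr rfl (g := fun _ => g F) fun R hR => hg _ _ (by simpa using hR), sum_const,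
    nsmul_eq_mul]
  ring

/-- The quasi-random homomorphism `φ_rdm`, the limit of the random tournaments. -/
noncomputable def phiRdm : PosHom emptyType where
  val n := Quotient.lift rdmDensity rdmDensity_congr
  nonneg n F := by
    obtain ⟨F, rfl⟩ := Quotient.exists_rep F
    exact div_nonneg (Nat.cast_nonneg _) (Nat.cast_nonneg _)
  one := by
    have h : ∀ R : Tournament (Fin 0), (TFlag.ofTournament R).Iso (TFlag.unit emptyType) :=
      fun R => ⟨Equiv.refl _, fun i => i.elim0, fun i => i.elim0⟩
    simp [rdmDensity, h]
  chain m ℓ F₁ hm := by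
    rw [sum_mul_rdmDensity _ (fun F G h => TFlag.density_congr F₁ h), Quotient.lift_mk, rdmDensity]
    have hE : ∀ R : Tournament (Fin ℓ), (TFlag.ofTournament R).extSets m =
        powersetCard m univ := by
      intro R
      ext S
      simp [TFlag.extSets, TFlag.labels_empty]
    have hpos : (0 : ℝ) < #(powersetCard m (univ : Finset (Fin ℓ))) := by
      rw [card_powersetCard]
      exact_mod_cast Nat.choose_pos (by simpa using hm)
    have hN : (0 : ℝ) < Fintype.card (Tournament (Fin m)) := by exact_mod_cast Fintype.card_pos
    have hL : (0 : ℝ) < Fintype.card (Tournament (Fin ℓ)) := by exact_mod_cast Fintype.card_pos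
    have hS : ∀ S ∈ powersetCard m (univ : Finset (Fin ℓ)),
        (#{R : Tournament (Fin ℓ) | (TFlag.ofTournament R).Induces S F₁} : ℝ) =
        #{R : Tournament (Fin m) | (TFlag.ofTournament R).Iso F₁} /
          Fintype.card (Tournament (Fin m)) * Fintype.card (Tournament (Fin ℓ)) := by
      intro S hS
      have e : Fin m ≃ S := (S.equivFinOfCardEq (mem_powersetCard.1 hS).2).symm
      have := Tournament.card_comap (e.toEmbedding.trans (Function.Embedding.subtype _))
        (fun A => (TFlag.ofTournament A).Iso F₁) (fun _ => True) (by simp)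
      simp only [and_true, ← TFlag.induces_iff_comap, filter_true, card_univ] at this
      rw [div_mul_eq_mul_div, eq_div_iff hN.ne', mul_comm]
      exact_mod_cast this
    simp only [TFlag.density, hE, ← sum_div]
    have hsum : ∑ R : Tournament (Fin ℓ), (#{S ∈ powersetCard m (univ : Finset (Fin ℓ)) |
          (TFlag.ofTournament R).Induces S F₁} : ℝ) =
        ∑ S ∈ powersetCard m (univ : Finset (Fin ℓ)),
          (#{R : Tournament (Fin ℓ) | (TFlag.ofTournament R).Induces S F₁} : ℝ) := by
      simp only [card_filter, Nat.cast_sum]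
      exact sum_comm
    rw [hsum, sum_congr rfl hS, sum_const, nsmul_eq_mul]
    field_simp
  mul m₁ m₂ ℓ F₁ F₂ hm := by
    rw [sum_mul_rdmDensity _ (fun F G h => TFlag.pairDensity_congr F₁ F₂ h), Quotient.lift_mk,
      Quotient.lift_mk, rdmDensity, rdmDensity]
    obtain ⟨E, hEdef⟩ : ∃ E : Finset (Finset (Fin ℓ) × Finset (Fin ℓ)),
      E = ({S | S.1 ∩ S.2 = ∅ ∧ #S.1 = m₁ ∧ #S.2 = m₂} : Finset _) := ⟨_, rfl⟩
    have hE : ∀ R : Tournament (Fin ℓ), (TFlag.ofTournament R).extPairs m₁ m₂ = E := by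
      intro R
      rw [hEdef]
      ext S
      simp [TFlag.extPairs, TFlag.labels_empty, Finset.ext_iff]
    have hpos : (0 : ℝ) < #E := by
      obtain ⟨S, -, hS⟩ := exists_subset_card_eq (s := (univ : Finset (Fin ℓ))) (n := m₁)
        (by simp; omega)
      have : (S, Sᶜ) ∈ E := by
        rw [hEdef]
        simp [card_compl, hS]
        omega
      exact_mod_cast card_pos.2 ⟨_, this⟩
    have hN₁ : (0 : ℝ) < Fintype.card (Tournament (Fin m₁)) := by exact_mod_cast Fintype.card_pos
    have hN₂ : (0 : ℝ) < Fintype.card (Tournament (Fin m₂)) := by exact_mod_cast Fintype.card_pos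
    have hL : (0 : ℝ) < Fintype.card (Tournament (Fin ℓ)) := by exact_mod_cast Fintype.card_pos
    have hS : ∀ S ∈ E,
        (#{R : Tournament (Fin ℓ) | (TFlag.ofTournament R).Induces S.1 F₁ ∧
          (TFlag.ofTournament R).Induces S.2 F₂} : ℝ) =
        #{R : Tournament (Fin m₁) | (TFlag.ofTournament R).Iso F₁} /
          Fintype.card (Tournament (Fin m₁)) *
        (#{R : Tournament (Fin m₂) | (TFlag.ofTournament R).Iso F₂} /
          Fintype.card (Tournament (Fin m₂))) * Fintype.card (Tournament (Fin ℓ)) := by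
      intro S hS
      rw [hEdef] at hS
      simp only [mem_filter, mem_univ, true_and] at hS
      obtain ⟨hd, h1, h2⟩ := hS
      have e₁ : Fin m₁ ≃ S.1 := (S.1.equivFinOfCardEq h1).symm
      have e₂ : Fin m₂ ≃ S.2 := (S.2.equivFinOfCardEq h2).symm
      have hdis : ∀ i j, (e₁.toEmbedding.trans (Function.Embedding.subtype _)) i ≠
          (e₂.toEmbedding.trans (Function.Embedding.subtype _)) j := by
        intro i j h
        have h1 : ((e₁ i : S.1) : Fin ℓ) = (e₂ j : S.2) := h
        have : ((e₁ i : S.1) : Fin ℓ) ∈ S.1 ∩ S.2 :=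
          mem_inter.2 ⟨(e₁ i).2, by rw [h1]; exact (e₂ j).2⟩
        rw [hd] at this
        simp at this
      have c1 := Tournament.card_comap (e₁.toEmbedding.trans (Function.Embedding.subtype _))
        (fun A => (TFlag.ofTournament A).Iso F₁)
        (fun T => (TFlag.ofTournament
          (T.comap (e₂.toEmbedding.trans (Function.Embedding.subtype _)))).Iso F₂)
        (fun T A => by rw [Tournament.comap_replace_of_disjoint _ _ _ _ hdis])
      have c2 := Tournament.card_comap (e₂.toEmbedding.trans (Function.Embedding.subtype _))
        (fun A => (TFlag.ofTournament A).Iso F₂) (fun _ => True) (by simp)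
      simp only [and_true, ← TFlag.induces_iff_comap, filter_true, card_univ] at c1 c2
      have c1' := congrArg (Nat.cast : ℕ → ℝ) c1
      have c2' := congrArg (Nat.cast : ℕ → ℝ) c2
      push_cast at c1' c2'
      field_simp
      linear_combination (Fintype.card (Tournament (Fin m₂)) : ℝ) * c1' +
        (#{R : Tournament (Fin m₁) | (TFlag.ofTournament R).Iso F₁} : ℝ) * c2'
    simp only [TFlag.pairDensity, hE, ← sum_div]
    have hsum : ∑ R : Tournament (Fin ℓ), (#{S ∈ E |
          (TFlag.ofTournament R).Induces S.1 F₁ ∧ (TFlag.ofTournament R).Induces S.2 F₂} : ℝ) =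
        ∑ S ∈ E, (#{R : Tournament (Fin ℓ) | (TFlag.ofTournament R).Induces S.1 F₁ ∧
          (TFlag.ofTournament R).Induces S.2 F₂} : ℝ) := by
      simp only [card_filter, Nat.cast_sum]
      exact sum_comm
    rw [hsum, sum_congr rfl hS, sum_const, nsmul_eq_mul]
    field_simp

/-- `T i` is a sequence of tournaments that is quasi-random: every fixed tournament occurs in it
with the same limiting density as in random tournaments. -/
def IsQuasiRandom {N : ℕ → ℕ} (T : ∀ i, Tournament (Fin (N i))) : Prop :=
  ∀ (m : ℕ) (H : Tournament (Fin m)),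
    Tendsto (fun i => (TFlag.ofTournament H).density (TFlag.ofTournament (T i))) atTop
      (𝓝 (phiRdm.eval (TFlag.ofTournament H)))

/-- For two vertices `u`, `v` of a tournament on `n` vertices, the number of vertices `w` with
`u → w → v`, divided by `n - 2`. -/
noncomputable def transRatio {n : ℕ} (T : Tournament (Fin n)) (u v : Fin n) : ℝ :=
  (#{w : Fin n | T.Adj u w ∧ T.Adj w v} : ℝ) / ((n : ℝ) - 2)

/-! Encode a tournament on `n` vertices by its skew-symmetric sign matrix. Let `score` be its row
sums and `codeg` the inner products of its rows. Expanding the indicator of `u → w → v` in signs and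
summing over `w` gives, for every arc `u → v`, `4(n-2)(transRatio u v - 1/4) = score u - score v -
codeg u v - 2` (`transRatio_identity`). Everything in part (ii) is read off from this.

Summed over all arcs, the score differences contribute `∑ score²` while the codegrees contribute
only about half of it. Hence small deviations force `∑ score² = o(n³)` (`sum_score_sq_le`), and the
identity then makes the codegrees small on average (`sum_abs_codeg_le`). By Cauchy–Schwarz, small
codegrees bound every bilinear form `∑ sign x y a(x) b(y)` with bounded `a`, `b`
(`sq_sum_sign_mul_le`). So the arcs can be replaced by fair coins one pair at a time when labelled
copies are counted (`abs_card_placement_sub_le`), and the sequence is quasi-random. Conversely, `∑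
score²` and `∑ codeg²` are sums of sign monomials over a cherry and a four-cycle. In a quasi-random
sequence the averages of these monomials vanish, since reversing one arc changes their sign, and the
identity returns small deviations in mean square.

Part (i) reduces to this. Drawing an `n`-vertex flag with the law given by `φ` concentrates all
densities, so `φ` is a limit of tournaments `T i` (`exists_tendsto_density`). The extension is a
weak limit of the density vectors of `T i` at a random placement of the labels
(`exists_isExtension`). The second moment of `φ^A(Tr_3^A) - 1/4` is the limit of the mean square
deviation of `transRatio` over the arcs of `T i` (`tendsto_average_sq_transRatio`). It vanishes
exactly when `T i` is quasi-random, that is, when `φ = phiRdm`. -/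

/-! ### Double counting in finite sets. -/

/-- Averaging over a biregular bipartite relation. -/
theorem sum_avg_div_card {α β : Type*} {A : Finset α} {B : Finset β} (r : α → β → Prop)
    [∀ a b, Decidable (r a b)] {c d : ℕ}    (hc : c ≠ 0) (hd : d ≠ 0) (hA : ∀ a ∈ A, #{b ∈ B | r a b} = d)
    (hB : ∀ b ∈ B, #{a ∈ A | r a b} = c) (g : β → ℝ) :
    (∑ a ∈ A, (∑ b ∈ B with r a b, g b) / d) / #A = (∑ b ∈ B, g b) / #B := by
  have h1 : #A * d = #B * c := card_mul_eq_card_mul r hA hB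
  have h1' : (#A * d : ℝ) = #B * c := by exact_mod_cast h1
  have hc' : (c : ℝ) ≠ 0 := by exact_mod_cast hc
  have hd' : (d : ℝ) ≠ 0 := by exact_mod_cast hd
  have h2 : ∑ a ∈ A, ∑ b ∈ B with r a b, g b = c * ∑ b ∈ B, g b := by
    simp only [sum_filter]
    rw [sum_comm, mul_sum]
    refine sum_congr rfl fun b hb => ?_
    rw [← sum_filter, sum_const, hB b hb, nsmul_eq_mul]
  rw [← sum_div, h2, div_div, mul_comm (d : ℝ), h1']
  -- With `B` empty both quotients have denominator zero, hence are zero by convention.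
  by_cases hB0 : (#B : ℝ) = 0
  · simp [hB0]
  · field_simp

/-- Such a set is `L` together with an arbitrary set of `m - #L` points outside `M`. -/
theorem card_filter_inter_eq {V : Type*} [Fintype V] {L M : Finset V} (hLM : L ⊆ M) {m : ℕ}
    (hm : #L ≤ m) :
    #{S : Finset V | M ∩ S = L ∧ #S = m} = (Fintype.card V - #M).choose (m - #L) := by
  rw [← card_compl, ← card_powersetCard]
  have hd : ∀ S : Finset V, S ⊆ Mᶜ → Disjoint S L := fun S hS =>
    disjoint_left.2 fun x hx hxL => (mem_compl.1 (hS hx)) (hLM hxL)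
  refine card_nbij' (fun S => S \ L) (fun S => S ∪ L) ?_ ?_ ?_ ?_
  · intro S hS
    simp only [coe_filter, mem_univ, true_and, Set.mem_ofPred_eq] at hS
    obtain ⟨hS, hc⟩ := hS
    have hLS : L ⊆ S := hS ▸ inter_subset_right
    simp only [mem_coe, mem_powersetCard]
    refine ⟨fun x hx => ?_, by rw [card_sdiff_of_subset hLS, hc]⟩
    rw [Finset.mem_sdiff] at hx
    rw [mem_compl]
    exact fun hxM => hx.2 (hS ▸ mem_inter.2 ⟨hxM, hx.1⟩)
  · intro S hS
    simp only [mem_coe, mem_powersetCard] at hS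
    simp only [coe_filter, mem_univ, true_and, Set.mem_ofPred_eq]
    constructor
    · rw [inter_union_distrib_left, inter_eq_right.2 hLM]
      have : M ∩ S = ∅ := disjoint_iff_inter_eq_empty.1
        (disjoint_left.2 fun x hx hxS => mem_compl.1 (hS.1 hxS) hx)
      rw [this, empty_union]
    · rw [card_union_of_disjoint (hd S hS.1), hS.2]
      omega
  · intro S hS
    simp only [coe_filter, mem_univ, true_and, Set.mem_ofPred_eq] at hS
    exact sdiff_union_of_subset (hS.1 ▸ inter_subset_right)
  · intro S hS
    simp only [mem_coe, mem_powersetCard] at hS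
    exact union_sdiff_cancel_right (hd S hS.1)

theorem card_filter_superset {V : Type*} [Fintype V] {L : Finset V} {m : ℕ} (hm : #L ≤ m) :
    #{S : Finset V | L ⊆ S ∧ #S = m} = (Fintype.card V - #L).choose (m - #L) := by
  rw [← card_filter_inter_eq subset_rfl hm]
  simp only [inter_eq_left]

theorem abs_card_div_sub_card_div_le {α : Type*} {X Y : Finset α} (hXY : Y ⊆ X)
    (hY : Y.Nonempty) (p : α → Prop) [DecidablePred p] :
    |(#{x ∈ X | p x} : ℝ) / #X - #{x ∈ Y | p x} / #Y| ≤ 1 - #Y / #X := by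
  have hy : (0 : ℝ) < #Y := by exact_mod_cast hY.card_pos
  have hx : (0 : ℝ) < #X := by exact_mod_cast (hY.mono hXY).card_pos
  have h1 : #{x ∈ X | p x} = #{x ∈ Y | p x} + #{x ∈ X \ Y | p x} := by
    rw [← card_union_of_disjoint, ← filter_union, union_sdiff_of_subset hXY]
    exact disjoint_filter_filter disjoint_sdiff
  have h2 : (#{x ∈ X \ Y | p x} : ℝ) ≤ #X - #Y := by
    have := card_filter_le (X \ Y) fun x => p x
    rw [card_sdiff_of_subset hXY] at this
    have h3 := card_le_card hXY
    have h4 : #{x ∈ X \ Y | p x} + #Y ≤ #X := by omega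
    have h5 : (#{x ∈ X \ Y | p x} : ℝ) + #Y ≤ #X := by exact_mod_cast h4
    linarith
  have h3 : (#{x ∈ Y | p x} : ℝ) ≤ #Y := by exact_mod_cast card_filter_le _ _
  have h4 : (#Y : ℝ) ≤ #X := by exact_mod_cast card_le_card hXY
  have ha : (0 : ℝ) ≤ #{x ∈ Y | p x} := Nat.cast_nonneg _
  have hb : (0 : ℝ) ≤ #{x ∈ X \ Y | p x} := Nat.cast_nonneg _
  rw [h1]
  push_cast
  generalize (#{x ∈ Y | p x} : ℝ) = a at *
  generalize (#{x ∈ X \ Y | p x} : ℝ) = b at *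
  generalize (#X : ℝ) = x at *
  generalize (#Y : ℝ) = y at *
  -- Both terms on the right lie between `0` and `1 - y / x`, so their difference is at most that in
  -- absolute value.
  have e : (a + b) / x - a / y = b / x - (a / y) * (1 - y / x) := by field_simp; ring
  have h5 : a / y ≤ 1 := by rw [div_le_one hy]; exact h3
  have h6 : 0 ≤ a / y := by positivity
  have h7 : 0 ≤ 1 - y / x := by rw [sub_nonneg, div_le_one hx]; exact h4
  have h8 : b / x ≤ 1 - y / x := by
    rw [div_le_iff₀ hx, sub_mul, div_mul_cancel₀ _ hx.ne']; linarith
  have h9 : 0 ≤ b / x := by positivity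
  rw [e, abs_le]
  constructor <;> nlinarith

/-! ### Flag densities: chain rules, asymptotic multiplicativity, averaging over labels. -/

namespace TFlag

variable {k : ℕ} {σ : Tournament (Fin k)} {V W U : Type*}

theorem card_labels (F : TFlag σ V) : #F.labels = k := by simp [labels]

theorem le_card [Fintype V] (F : TFlag σ V) : k ≤ Fintype.card V := by
  simpa using Fintype.card_le_of_embedding F.label

theorem size_le {m : ℕ} (F : TFlag σ (Fin m)) : k ≤ m := by simpa using F.le_card

theorem card_extSets [Fintype V] (F : TFlag σ V) {m : ℕ} (hm : k ≤ m) :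
    #(F.extSets m) = (Fintype.card V - k).choose (m - k) := by
  have := card_filter_superset (L := F.labels) (m := m) (by rwa [card_labels])
  rwa [card_labels] at this

theorem card_extPairs [Fintype V] (F : TFlag σ V) {m₁ m₂ : ℕ} (h₁ : k ≤ m₁) (h₂ : k ≤ m₂) :
    #(F.extPairs m₁ m₂) =
      (Fintype.card V - k).choose (m₁ - k) * (Fintype.card V - m₁).choose (m₂ - k) := by
  rw [← F.card_extSets h₁, ← smul_eq_mul, ← sum_const]
  rw [card_eq_sum_card_fiberwise (f := Prod.fst) (t := F.extSets m₁)]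
  · refine sum_congr rfl fun S hS => ?_
    simp only [extSets, mem_filter, mem_univ, true_and] at hS
    have := card_filter_inter_eq (L := F.labels) hS.1 (m := m₂) (by rwa [card_labels])
    rw [card_labels, hS.2] at this
    rw [← this]
    refine card_nbij' Prod.snd (fun S' => (S, S')) ?_ ?_ ?_ ?_
    · rintro ⟨S', S''⟩ h
      simp only [extPairs, coe_filter, mem_filter, mem_univ, true_and, Set.mem_ofPred_eq] at h ⊢
      obtain ⟨h, rfl⟩ := h
      exact ⟨h.1, h.2.2⟩
    · intro S' h
      simp only [extPairs, coe_filter, mem_filter, mem_univ, true_and, Set.mem_ofPred_eq] at h ⊢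
      exact ⟨⟨h.1, hS.2, h.2⟩, trivial⟩
    · rintro ⟨S', S''⟩ h
      simp only [extPairs, coe_filter, mem_filter, mem_univ, true_and, Set.mem_ofPred_eq] at h ⊢
      obtain ⟨h, rfl⟩ := h
      rfl
    · intro S' h
      rfl
  · rintro ⟨S, S'⟩ h
    simp only [extPairs, coe_filter, mem_univ, true_and, Set.mem_ofPred_eq] at h
    simp only [extSets, coe_filter, mem_univ, true_and, Set.mem_ofPred_eq]
    exact ⟨h.1 ▸ inter_subset_left, h.2.1⟩

/-- An embedding of flags: an embedding of vertices preserving arcs and labels. -/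
def IsEmb (F : TFlag σ V) (G : TFlag σ W) (e : V ↪ W) : Prop :=
  (∀ u v, G.model.Adj (e u) (e v) ↔ F.model.Adj u v) ∧ ∀ i, e (F.label i) = G.label i

theorem IsEmb.labels_map {F : TFlag σ V} {G : TFlag σ W} {e : V ↪ W} (he : F.IsEmb G e) :
    F.labels.map e = G.labels := by
  have h : F.label.trans e = G.label := DFunLike.ext _ _ he.2
  simp only [labels, Finset.map_map, h]

theorem IsEmb.labels_subset {F : TFlag σ V} {G : TFlag σ W} {e : V ↪ W} (he : F.IsEmb G e)
    {S : Finset V} : G.labels ⊆ S.map e ↔ F.labels ⊆ S := by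
  rw [← he.labels_map, map_subset_map]

theorem IsEmb.induces_map {F : TFlag σ V} {G : TFlag σ W} {e : V ↪ W} (he : F.IsEmb G e)
    (S : Finset V) (F₁ : TFlag σ U) : G.Induces (S.map e) F₁ ↔ F.Induces S F₁ := by
  have key : ∀ (h : F.labels ⊆ S) (h' : G.labels ⊆ S.map e),
      (F.induce S h).Iso (G.induce _ h') := fun h h' =>
    ⟨Finset.equivMap e S, fun u v => he.1 _ _, fun i => Subtype.ext (he.2 i)⟩
  exact ⟨fun ⟨h, hi⟩ => ⟨he.labels_subset.1 h, (key _ _).trans hi⟩,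
    fun ⟨h, hi⟩ => ⟨he.labels_subset.2 h, (key _ _).symm.trans hi⟩⟩

theorem induces_univ [Fintype V] {F : TFlag σ V} {F₁ : TFlag σ U} :
    F.Induces univ F₁ ↔ F.Iso F₁ := by
  have key : (F.induce univ (subset_univ _)).Iso F :=
    ⟨Equiv.subtypeUnivEquiv mem_univ, fun _ _ => Iff.rfl, fun _ => rfl⟩
  exact ⟨fun ⟨_, h⟩ => key.symm.trans h, fun h => ⟨subset_univ _, key.trans h⟩⟩

theorem induces_iff_exists_isEmb [Fintype U] {G : TFlag σ V} {S : Finset V} {F : TFlag σ U} :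
    G.Induces S F ↔ ∃ e : U ↪ V, univ.map e = S ∧ F.IsEmb G e := by
  constructor
  · rintro ⟨h, hi⟩
    obtain ⟨e, he, hl⟩ := hi.symm
    refine ⟨e.toEmbedding.trans (Function.Embedding.subtype _), ?_, ?_, ?_⟩
    · rw [← Finset.map_map, map_univ_equiv]
      ext x
      simp
    · exact he
    · intro i
      exact congrArg Subtype.val (hl i)
  · rintro ⟨e, rfl, he⟩
    rw [he.induces_map, induces_univ]
    exact Iso.refl _

theorem Induces.card_eq [Fintype U] {G : TFlag σ V} {S : Finset V} {F : TFlag σ U}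
    (h : G.Induces S F) : #S = Fintype.card U := by
  obtain ⟨e, rfl, -⟩ := induces_iff_exists_isEmb.1 h
  simp

theorem Induces.iso {G : TFlag σ V} {S : Finset V} {F : TFlag σ U} {F' : TFlag σ W}
    (h : G.Induces S F) (h' : G.Induces S F') : F.Iso F' := by
  obtain ⟨_, h⟩ := h
  obtain ⟨_, h'⟩ := h'
  exact h.symm.trans h'

theorem Induces.congr {G : TFlag σ V} {S : Finset V} {F : TFlag σ U} {F' : TFlag σ W}
    (h : G.Induces S F) (h' : F.Iso F') : G.Induces S F' :=
  ⟨h.1, h.2.trans h'⟩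

theorem exists_induces {G : TFlag σ V} {S : Finset V} (h : G.labels ⊆ S) {ℓ : ℕ} (hS : #S = ℓ) :
    ∃ F : TFlag σ (Fin ℓ), G.Induces S F := by
  let e := S.equivFinOfCardEq hS
  refine ⟨⟨(G.induce S h).model.comap e.symm.toEmbedding,
    (G.induce S h).label.trans e.toEmbedding, fun i j => ?_⟩, h, e, fun u v => ?_, fun i => rfl⟩
  · rw [← (G.induce S h).label_adj i j]
    simp [Tournament.comap]
  · simp [Tournament.comap]

/-- Expanding a weighted sum of densities over the vertex sets of the big flag. -/
theorem sum_mul_density [Fintype V] (G : TFlag σ V) {ℓ : ℕ} (g : TFlag σ (Fin ℓ) → ℝ)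
    (g' : Finset V → ℝ) (hg : ∀ S ∈ G.extSets ℓ, ∀ F, G.Induces S F → g F = g' S) :
    ∑ F : FlagClass σ ℓ, g F.out * F.out.density G =
      (∑ S ∈ G.extSets ℓ, g' S) / #(G.extSets ℓ) := by
  simp only [density, mul_div_assoc', ← sum_div]
  congr 1
  simp only [card_filter, Nat.cast_sum, mul_sum]
  rw [sum_comm]
  refine sum_congr rfl fun S hS => ?_
  have hS' : G.labels ⊆ S ∧ #S = ℓ := by simpa [extSets] using hS
  obtain ⟨F, hF⟩ := exists_induces hS'.1 hS'.2
  -- Each `S` induces exactly one isomorphism class, so only that class contributes.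
  rw [sum_eq_single (⟦F⟧ : FlagClass σ ℓ)]
  · have : G.Induces S (Quotient.out (⟦F⟧ : FlagClass σ ℓ)) :=
      hF.congr (Iso.symm (Quotient.mk_out F))
    rw [if_pos this, hg S hS _ this]
    simp
  · intro F' _ hF'
    rw [if_neg]
    · simp
    · intro h
      exact hF' ((Quotient.out_eq F').symm.trans (Quotient.sound (h.iso hF)))
  · simp

theorem IsEmb.map_extSets [Fintype V] [Fintype W] {F : TFlag σ V} {G : TFlag σ W} {e : V ↪ W}
    (he : F.IsEmb G e) (m : ℕ) :
    (F.extSets m).map (mapEmbedding e).toEmbedding =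
      {S ∈ G.extSets m | S ⊆ univ.map e} := by
  ext S
  simp only [Finset.mem_map, extSets, mem_filter, mem_univ, true_and, subset_map_iff]
  constructor
  · rintro ⟨S', ⟨h1, h2⟩, rfl⟩
    refine ⟨⟨he.labels_subset.2 h1, by simpa using h2⟩, S', subset_univ _, rfl⟩
  · rintro ⟨⟨h1, h2⟩, S', -, rfl⟩
    exact ⟨S', ⟨he.labels_subset.1 h1, by simpa using h2⟩, rfl⟩

theorem IsEmb.map_extPairs [Fintype V] [Fintype W] {F : TFlag σ V} {G : TFlag σ W} {e : V ↪ W}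
    (he : F.IsEmb G e) (m₁ m₂ : ℕ) :
    (F.extPairs m₁ m₂).map ((mapEmbedding e).toEmbedding.prodMap (mapEmbedding e).toEmbedding) =
      {S ∈ G.extPairs m₁ m₂ | S.1 ⊆ univ.map e ∧ S.2 ⊆ univ.map e} := by
  have key : ∀ S S' : Finset V, S.map e ∩ S'.map e = G.labels ↔ S ∩ S' = F.labels := by
    intro S S'
    rw [← map_inter, ← he.labels_map, Finset.map_inj]
  ext ⟨S₁, S₂⟩
  simp only [Finset.mem_map, extPairs, mem_filter, mem_univ, true_and, subset_map_iff]
  constructor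
  · rintro ⟨⟨S, S'⟩, ⟨h1, h2, h3⟩, h⟩
    obtain ⟨rfl, rfl⟩ := Prod.mk.inj h
    refine ⟨⟨(key _ _).2 h1, by simpa using h2, by simpa using h3⟩, ⟨S, subset_univ _, rfl⟩,
      ⟨S', subset_univ _, rfl⟩⟩
  · rintro ⟨⟨h1, h2, h3⟩, ⟨S, -, rfl⟩, ⟨S', -, rfl⟩⟩
    exact ⟨(S, S'), ⟨(key _ _).1 h1, by simpa using h2, by simpa using h3⟩, rfl⟩

/-- A uniform `m`-set inside a uniform `ℓ`-set, both containing the labels, is a uniform `m`-set: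
inclusion is a biregular relation between the two families. -/
theorem density_chain [Fintype V] (G : TFlag σ V) {m ℓ : ℕ} (F₁ : TFlag σ (Fin m)) (hm : m ≤ ℓ)
    (hℓ : ℓ ≤ Fintype.card V) :
    F₁.density G = ∑ F : FlagClass σ ℓ, F₁.density F.out * F.out.density G := by
  have hk := F₁.size_le
  rw [sum_mul_density G F₁.density (fun S => (∑ S₁ ∈ G.extSets m with S₁ ⊆ S,
    if G.Induces S₁ F₁ then (1 : ℝ) else 0) / ((ℓ - k).choose (m - k) : ℕ))]
  · rw [sum_avg_div_card (fun S S₁ : Finset V => S₁ ⊆ S) (c := (Fintype.card V - m).choose (ℓ - m))]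
    · simp [density]
    · exact (Nat.choose_pos (by omega)).ne'
    · exact (Nat.choose_pos (by omega)).ne'
    · intro S hS
      have hS' : G.labels ⊆ S ∧ #S = ℓ := by simpa [extSets] using hS
      obtain ⟨F, hF⟩ := exists_induces hS'.1 hS'.2
      obtain ⟨e, rfl, he⟩ := induces_iff_exists_isEmb.1 hF
      rw [← he.map_extSets, card_map, card_extSets _ hk, Fintype.card_fin]
    · intro S₁ hS₁
      have hS' : G.labels ⊆ S₁ ∧ #S₁ = m := by simpa [extSets] using hS₁
      rw [← hS'.2, ← card_filter_superset (by omega)]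
      congr 1
      ext S
      simp only [extSets, mem_filter, mem_univ, true_and]
      exact ⟨fun h => ⟨h.2, h.1.2⟩, fun h => ⟨⟨hS'.1.trans h.1, h.2⟩, h.1⟩⟩
  · intro S hS F hF
    obtain ⟨e, rfl, he⟩ := induces_iff_exists_isEmb.1 hF
    rw [← he.map_extSets, sum_map, density, F.card_extSets hk, Fintype.card_fin]
    simp [he.induces_map]

/-- As in `density_chain`, but the size condition makes the union of an admissible pair have exactly
`ℓ` elements. The pair therefore determines the `ℓ`-set containing it, and one of the two degrees is
`1`. -/
theorem pairDensity_chain [Fintype V] (G : TFlag σ V) {m₁ m₂ ℓ : ℕ} (F₁ : TFlag σ (Fin m₁))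
    (F₂ : TFlag σ (Fin m₂)) (hm : ℓ + k = m₁ + m₂) :
    F₁.pairDensity F₂ G = ∑ F : FlagClass σ ℓ, F₁.pairDensity F₂ F.out * F.out.density G := by
  have hk₁ := F₁.size_le
  have hk₂ := F₂.size_le
  rw [sum_mul_density G (F₁.pairDensity F₂) (fun S =>
    (∑ p ∈ G.extPairs m₁ m₂ with p.1 ⊆ S ∧ p.2 ⊆ S,
    if G.Induces p.1 F₁ ∧ G.Induces p.2 F₂ then (1 : ℝ) else 0) /
      ((ℓ - k).choose (m₁ - k) * (ℓ - m₁).choose (m₂ - k) : ℕ))]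
  · rw [sum_avg_div_card (fun (S : Finset V) (p : Finset V × Finset V) => p.1 ⊆ S ∧ p.2 ⊆ S) (c := 1)]
    · simp [pairDensity]
    · exact one_ne_zero
    · exact (Nat.mul_pos (Nat.choose_pos (by omega)) (Nat.choose_pos (by omega))).ne'
    · intro S hS
      have hS' : G.labels ⊆ S ∧ #S = ℓ := by simpa [extSets] using hS
      obtain ⟨F, hF⟩ := exists_induces hS'.1 hS'.2
      obtain ⟨e, rfl, he⟩ := induces_iff_exists_isEmb.1 hF
      rw [← he.map_extPairs, card_map, card_extPairs _ hk₁ hk₂, Fintype.card_fin]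
    · rintro ⟨S₁, S₂⟩ hp
      have hp' : S₁ ∩ S₂ = G.labels ∧ #S₁ = m₁ ∧ #S₂ = m₂ := by simpa [extPairs] using hp
      have hu : #(S₁ ∪ S₂) = ℓ := by
        have := card_union_add_card_inter S₁ S₂
        rw [hp'.1, card_labels] at this
        omega
      rw [card_eq_one]
      refine ⟨S₁ ∪ S₂, ?_⟩
      ext S
      simp only [extSets, mem_filter, mem_univ, true_and, mem_singleton]
      constructor
      · rintro ⟨⟨-, h⟩, h1, h2⟩
        exact (eq_of_subset_of_card_le (union_subset h1 h2) (by omega)).symm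
      · rintro rfl
        exact ⟨⟨hp'.1 ▸ inter_subset_union, hu⟩, subset_union_left, subset_union_right⟩
  · intro S hS F hF
    obtain ⟨e, rfl, he⟩ := induces_iff_exists_isEmb.1 hF
    rw [← he.map_extPairs, sum_map, pairDensity, F.card_extPairs hk₁ hk₂, Fintype.card_fin]
    simp [he.induces_map, Function.Embedding.prodMap]

theorem density_nonneg [Fintype V] {m : ℕ} (F : TFlag σ (Fin m)) (G : TFlag σ V) :
    0 ≤ F.density G := by unfold density; positivity

theorem density_le_one [Fintype V] {m : ℕ} (F : TFlag σ (Fin m)) (G : TFlag σ V) :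
    F.density G ≤ 1 :=
  div_le_one_of_le₀ (by exact_mod_cast card_filter_le _ _) (Nat.cast_nonneg _)

/-- The product of densities samples two sets independently; the joint density conditions on their
meeting only in the labels. The binomial quotient is the probability of that condition, and
conditioning changes a probability by at most that of the complement. -/
theorem abs_density_mul_sub_pairDensity_le [Fintype V] (G : TFlag σ V) {m₁ m₂ : ℕ}
    (F₁ : TFlag σ (Fin m₁)) (F₂ : TFlag σ (Fin m₂)) (hV : m₁ + m₂ ≤ Fintype.card V) :
    |F₁.density G * F₂.density G - F₁.pairDensity F₂ G| ≤
      1 - ((Fintype.card V - m₁).choose (m₂ - k) : ℝ) / (Fintype.card V - k).choose (m₂ - k) := by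
  have hk₁ := F₁.size_le
  have hk₂ := F₂.size_le
  have hsub : G.extPairs m₁ m₂ ⊆ G.extSets m₁ ×ˢ G.extSets m₂ := by
    rintro ⟨S₁, S₂⟩ h
    simp only [extPairs, extSets, mem_filter, mem_univ, true_and, mem_product] at h ⊢
    exact ⟨⟨h.1 ▸ inter_subset_left, h.2.1⟩, h.1 ▸ inter_subset_right, h.2.2⟩
  have hne : (G.extPairs m₁ m₂).Nonempty := by
    rw [← card_pos, card_extPairs _ hk₁ hk₂]
    exact Nat.mul_pos (Nat.choose_pos (by omega)) (Nat.choose_pos (by omega))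
  have h := abs_card_div_sub_card_div_le hsub hne
    (fun S => G.Induces S.1 F₁ ∧ G.Induces S.2 F₂)
  rw [filter_product (fun S => G.Induces S F₁) (fun S => G.Induces S F₂), card_product, card_product,
    card_extPairs _ hk₁ hk₂, card_extSets _ hk₁, card_extSets _ hk₂] at h
  rw [density, density, pairDensity, div_mul_div_comm, card_extPairs _ hk₁ hk₂,
    card_extSets _ hk₁, card_extSets _ hk₂]
  push_cast at h ⊢
  rwa [mul_div_mul_left] at h
  exact_mod_cast (Nat.choose_pos (by omega)).ne'

end TFlag

theorem tendsto_choose_sub_div_choose_sub (a b c : ℕ) :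
    Tendsto (fun n : ℕ => ((n - a).choose c : ℝ) / (n - b).choose c) atTop (𝓝 1) := by
  have h : ∀ a : ℕ, (fun n : ℕ => ((n - a).choose c : ℝ)) ~[atTop]
      fun n : ℕ => (n : ℝ) ^ c / c.factorial := by
    intro a
    refine ((isEquivalent_choose c).comp_tendsto (tendsto_sub_atTop_nat a)).trans ?_
    have h1 : (fun n : ℕ => ((n - a : ℕ) : ℝ)) ~[atTop] fun n : ℕ => (n : ℝ) := by
      refine IsEquivalent.congr_left (u := fun n : ℕ => (n : ℝ) - a) ?_ ?_
      · refine IsLittleO.isEquivalent ?_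
        have : ((fun n : ℕ => (n : ℝ) - a) - fun n : ℕ => (n : ℝ)) = fun _ => -(a : ℝ) := by
          ext; simp
        rw [this]
        exact isLittleO_const_left.2 (Or.inr (tendsto_norm_atTop_atTop.comp
          tendsto_natCast_atTop_atTop))
      · filter_upwards [eventually_ge_atTop a] with n hn
        rw [Nat.cast_sub hn]
    exact (h1.pow c).div IsEquivalent.refl
  refine (isEquivalent_iff_tendsto_one ?_).1 ((h a).trans (h b).symm)
  filter_upwards [eventually_ge_atTop (b + c)] with n hn
  exact_mod_cast (Nat.choose_pos (by omega)).ne'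

namespace TFlag

variable {k : ℕ} {σ : Tournament (Fin k)} {V W U : Type*}

/-- Disjointness of two random vertex sets costs nothing asymptotically. -/
theorem eventually_abs_density_mul_sub_pairDensity_le {m₁ m₂ : ℕ}
    (F₁ : TFlag σ (Fin m₁)) (F₂ : TFlag σ (Fin m₂)) {ε : ℝ} (hε : 0 < ε) :
    ∀ᶠ n in atTop, ∀ G : TFlag σ (Fin n),
      |F₁.density G * F₂.density G - F₁.pairDensity F₂ G| ≤ ε := by
  have h := (tendsto_choose_sub_div_choose_sub m₁ k (m₂ - k)).eventually
    (lt_mem_nhds (show 1 - ε < 1 by linarith))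
  filter_upwards [h, eventually_ge_atTop (m₁ + m₂)] with n hn hm G
  have := abs_density_mul_sub_pairDensity_le G F₁ F₂ (by simpa using hm)
  rw [Fintype.card_fin] at this
  linarith

/-- Averaging the density of a flag over all placements of the labels. -/
theorem sum_density_label [Fintype V] (T : Tournament V) {m : ℕ} (F : TFlag σ (Fin m))
    (hV : m ≤ Fintype.card V) :
    (∑ θ : Fin k ↪ V, if h : ∀ i j, T.Adj (θ i) (θ j) ↔ σ.Adj i j then
      F.density (⟨T, θ, h⟩ : TFlag σ V) else 0) / Fintype.card (Fin k ↪ V) =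
    F.labelProb * (ofTournament F.model).density (ofTournament T) := by
  have hk := F.size_le
  -- Double counting over pairs of a labelling and an `m`-set containing the labels. Averaging over
  -- the set first gives densities of labelled flags; averaging over the labelling first gives
  -- `labelProb` times the unlabelled density.
  set B : Finset ((Fin k ↪ V) × Finset V) := {p | univ.map p.1 ⊆ p.2 ∧ #p.2 = m} with hB
  set g : (Fin k ↪ V) × Finset V → ℝ := fun p =>
    if ∃ h : ∀ i j, T.Adj (p.1 i) (p.1 j) ↔ σ.Adj i j, (⟨T, p.1, h⟩ : TFlag σ V).Induces p.2 F
    then 1 else 0 with hg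
  have hE : (ofTournament T).extSets m = powersetCard m univ := by
    ext S
    simp [extSets, labels_empty]
  have e1 : ∀ θ : Fin k ↪ V, #{p ∈ B | θ = p.1} = (Fintype.card V - k).choose (m - k) := by
    intro θ
    have := card_filter_superset (L := univ.map θ) (m := m) (by simpa)
    rw [card_map, card_univ, Fintype.card_fin] at this
    rw [← this]
    refine card_nbij' Prod.snd (fun S => (θ, S)) ?_ ?_ ?_ ?_
    · rintro ⟨θ', S⟩ h
      simp only [hB, coe_filter, mem_filter, mem_univ, true_and, Set.mem_ofPred_eq] at h ⊢
      obtain ⟨h, rfl⟩ := h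
      exact h
    · intro S h
      simpa [hB] using h
    · rintro ⟨θ', S⟩ h
      simp only [hB, coe_filter, mem_filter, mem_univ, true_and, Set.mem_ofPred_eq] at h ⊢
      obtain ⟨h, rfl⟩ := h
      rfl
    · intro S _
      rfl
  have hmap : ∀ (e : Fin m ↪ V), {p ∈ B | univ.map e = p.2} =
      (univ : Finset (Fin k ↪ Fin m)).map
        ⟨fun θ => (θ.trans e, univ.map e), fun θ θ' h => by
          ext i
          have := DFunLike.congr_fun (Prod.mk.inj h).1 i
          exact congrArg Fin.val (e.injective this)⟩ := by
    intro e
    ext ⟨θ, S⟩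
    simp only [hB, mem_filter, mem_univ, true_and, Finset.mem_map]
    constructor
    · rintro ⟨⟨h1, h2⟩, rfl⟩
      have h3 : ∀ i, ∃ j, e j = θ i := by
        intro i
        have := h1 (mem_map_of_mem θ (mem_univ i))
        simpa using this
      choose f hf using h3
      refine ⟨⟨f, fun i j hij => θ.injective ?_⟩, Prod.ext (DFunLike.ext _ _ hf) rfl⟩
      rw [← hf, ← hf, hij]
    · rintro ⟨θ', h⟩
      obtain ⟨rfl, rfl⟩ := Prod.mk.inj h
      refine ⟨⟨?_, by simp⟩, rfl⟩
      rw [← Finset.map_map]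
      exact map_subset_map.2 (subset_univ _)
  have e2 : ∀ S ∈ powersetCard m (univ : Finset V),
      #{p ∈ B | S = p.2} = Fintype.card (Fin k ↪ Fin m) := by
    intro S hS
    obtain ⟨e, rfl⟩ : ∃ e : Fin m ↪ V, univ.map e = S := by
      refine ⟨((S.equivFinOfCardEq (mem_powersetCard.1 hS).2).symm.toEmbedding.trans
        (Function.Embedding.subtype _)), ?_⟩
      rw [← Finset.map_map, map_univ_equiv]
      ext x
      simp
    rw [hmap, card_map, card_univ]
  have h1 := sum_avg_div_card (A := univ) (B := B) (fun θ p => θ = p.1) (c := 1) one_ne_zero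
    (d := (Fintype.card V - k).choose (m - k))
    (Nat.choose_pos (by omega)).ne' (fun θ _ => e1 θ)
    (fun p _ => by rw [filter_eq' univ p.1]; simp) g
  have h2 := sum_avg_div_card (A := powersetCard m (univ : Finset V)) (B := B)
    (fun S p => S = p.2) (c := 1) one_ne_zero (d := Fintype.card (Fin k ↪ Fin m)) (by
      have : Nonempty (Fin k ↪ Fin m) := ⟨F.label⟩
      exact Fintype.card_ne_zero) e2
    (fun p hp => by
      have : #p.2 = m := by
        simp only [hB, mem_filter] at hp
        exact hp.2.2
      simp [filter_eq', this]) g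
  rw [← h1, card_univ] at h2
  have h3 : ∀ θ : Fin k ↪ V, (if h : ∀ i j, T.Adj (θ i) (θ j) ↔ σ.Adj i j then
      F.density (⟨T, θ, h⟩ : TFlag σ V) else 0) = (∑ p ∈ B with θ = p.1, g p) /
        ((Fintype.card V - k).choose (m - k) : ℕ) := by
    intro θ
    split_ifs with h
    · rw [density, card_extSets _ hk, hg, sum_boole]
      congr 2
      refine card_nbij' (fun S => (θ, S)) Prod.snd ?_ ?_ ?_ ?_
      · intro S hS
        simp only [hB, extSets, labels, coe_filter, mem_filter, mem_univ, true_and,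
          Set.mem_ofPred_eq] at hS ⊢
        exact ⟨⟨(mem_filter.1 hS.1).2, trivial⟩, h, hS.2⟩
      · rintro ⟨θ', S⟩ hS
        simp only [hB, extSets, labels, coe_filter, mem_filter, mem_univ, true_and,
          Set.mem_ofPred_eq] at hS ⊢
        obtain ⟨⟨h1, rfl⟩, _, h3⟩ := hS
        exact ⟨mem_filter.2 ⟨mem_univ _, h1⟩, h3⟩
      · intro S _
        rfl
      · rintro ⟨θ', S⟩ hS
        simp only [coe_filter, mem_filter, Set.mem_ofPred_eq] at hS ⊢
        obtain ⟨⟨h1, rfl⟩, -⟩ := hS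
        rfl
    · rw [sum_eq_zero, zero_div]
      rintro ⟨θ', S⟩ hp
      obtain rfl : θ = θ' := (mem_filter.1 hp).2
      simp [hg, h]
  -- If `S` carries a copy of the model, the labellings inside `S` that yield `F` are those counted
  -- by `labelProb`; otherwise there are none.
  have h4 : ∀ S ∈ powersetCard m (univ : Finset V), (∑ p ∈ B with S = p.2, g p) /
      (Fintype.card (Fin k ↪ Fin m) : ℕ) =
        F.labelProb * (if (ofTournament T).Induces S (ofTournament F.model) then 1 else 0) := by
    intro S hS
    split_ifs with h
    · obtain ⟨e, rfl, he⟩ := induces_iff_exists_isEmb.1 h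
      rw [hmap, sum_map, labelProb, mul_one]
      congr 1
      simp only [hg, sum_boole]
      congr 2
      ext θ
      have hv : (∀ i j, T.Adj ((θ.trans e) i) ((θ.trans e) j) ↔ σ.Adj i j) ↔
          ∀ i j, F.model.Adj (θ i) (θ j) ↔ σ.Adj i j :=
        forall₂_congr fun i j => iff_congr (he.1 _ _) Iff.rfl
      simp only [mem_filter, mem_univ, true_and]
      constructor
      · rintro ⟨h1, h2⟩
        refine ⟨hv.1 h1, induces_univ.1 ?_⟩
        refine (IsEmb.induces_map (F := ⟨F.model, θ, hv.1 h1⟩) (G := ⟨T, θ.trans e, h1⟩)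
          ⟨he.1, fun _ => rfl⟩ univ F).1 h2
      · rintro ⟨h1, h2⟩
        refine ⟨hv.2 h1, ?_⟩
        exact (IsEmb.induces_map (F := ⟨F.model, θ, h1⟩) (G := ⟨T, θ.trans e, hv.2 h1⟩)
          ⟨he.1, fun _ => rfl⟩ univ F).2 (induces_univ.2 h2)
    · rw [sum_eq_zero, zero_div, mul_zero]
      rintro ⟨θ, S'⟩ hp
      obtain rfl : S = S' := (mem_filter.1 hp).2
      simp only [hg, ite_eq_right_iff, one_ne_zero, imp_false]
      rintro ⟨h1, h2⟩
      obtain ⟨e, he, he'⟩ := induces_iff_exists_isEmb.1 h2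
      exact h (induces_iff_exists_isEmb.2 ⟨e, he, he'.1, fun i => i.elim0⟩)
  simp only [h3]
  rw [← h2, sum_congr rfl h4, ← mul_sum, density, hE, sum_boole, mul_div_assoc]

end TFlag

theorem TFlag.density_unit {k : ℕ} {σ : Tournament (Fin k)} {V : Type*} [Fintype V]
    (G : TFlag σ V) : (TFlag.unit σ).density G = 1 := by
  have h1 : G.extSets k = {G.labels} := by
    ext S
    simp only [extSets, mem_filter, mem_univ, true_and, mem_singleton]
    constructor
    · rintro ⟨h1, h2⟩
      exact (eq_of_subset_of_card_le h1 (by rw [h2, G.card_labels])).symm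
    · rintro rfl
      exact ⟨subset_rfl, G.card_labels⟩
  have h2 : G.Induces G.labels (TFlag.unit σ) :=
    TFlag.induces_iff_exists_isEmb.2 ⟨G.label, rfl, G.label_adj, fun _ => rfl⟩
  rw [density, h1, filter_singleton, if_pos h2]
  simp

/-! ### Positive homomorphisms as limits of finite flags. -/

namespace PosHom

variable {k : ℕ} {σ : Tournament (Fin k)}

theorem eval_out (φ : PosHom σ) {n : ℕ} (F : FlagClass σ n) : φ.eval F.out = φ.val n F := by
  rw [eval, Quotient.out_eq]

theorem eval_nonneg (φ : PosHom σ) {n : ℕ} (F : TFlag σ (Fin n)) : 0 ≤ φ.eval F := φ.nonneg _ _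

theorem eval_eq_sum (φ : PosHom σ) {m n : ℕ} (F₁ : TFlag σ (Fin m)) (h : m ≤ n) :
    φ.eval F₁ = ∑ F : FlagClass σ n, F₁.density F.out * φ.val n F := φ.chain m n F₁ h

/-- The unit has density `1` in every flag, so the chain rule makes the values on flags of each
order a probability distribution. This is the random flag used below. -/
theorem sum_val (φ : PosHom σ) {n : ℕ} (hn : k ≤ n) : ∑ F : FlagClass σ n, φ.val n F = 1 := by
  rw [← φ.one, φ.chain k n _ hn]
  simp [TFlag.density_unit]

theorem eval_le_one (φ : PosHom σ) {n : ℕ} (F : TFlag σ (Fin n)) : φ.eval F ≤ 1 := by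
  rw [← φ.sum_val F.size_le]
  exact single_le_sum (f := fun F => φ.val n F) (fun F _ => φ.nonneg n F) (mem_univ _)

/-- The chain rule lifts the product formula from order `ℓ` to any larger order, so that moments can
be compared at one order `n`. -/
theorem eval_mul_eval (φ : PosHom σ) {m₁ m₂ ℓ n : ℕ} (F₁ : TFlag σ (Fin m₁))
    (F₂ : TFlag σ (Fin m₂)) (hℓ : ℓ + k = m₁ + m₂) (hn : ℓ ≤ n) :
    φ.eval F₁ * φ.eval F₂ = ∑ G : FlagClass σ n, F₁.pairDensity F₂ G.out * φ.val n G := by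
  rw [eval, eval, φ.mul m₁ m₂ ℓ F₁ F₂ hℓ]
  simp only [← eval_out φ (n := ℓ), eval_eq_sum φ _ hn, mul_sum]
  rw [sum_comm]
  refine sum_congr rfl fun G _ => ?_
  rw [TFlag.pairDensity_chain G.out F₁ F₂ hℓ, sum_mul]
  exact sum_congr rfl fun F _ => by ring

/-- The density of a fixed flag in a random flag drawn from `φ` is concentrated. -/
theorem eventually_sum_sq_le (φ : PosHom σ) {m : ℕ} (F : TFlag σ (Fin m)) {ε : ℝ} (hε : 0 < ε) :
    ∀ᶠ n in atTop, ∑ G : FlagClass σ n, (F.density G.out - φ.eval F) ^ 2 * φ.val n G ≤ ε := by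
  have hk := F.size_le
  filter_upwards [TFlag.eventually_abs_density_mul_sub_pairDensity_le F F hε,
    eventually_ge_atTop (m + m)] with n hn hm
  have h1 := φ.eval_eq_sum F (n := n) (by omega)
  have h2 := φ.eval_mul_eval F F (ℓ := m + m - k) (n := n) (by omega) (by omega)
  have h3 := φ.sum_val (n := n) (by omega)
  -- The sum is a variance: the mean of `F.density` is `φ.eval F`, and its square is the mean of the
  -- joint density by `h2`. What remains is the mean of density squared minus joint density, which
  -- is uniformly small.
  have h4 : ∑ G : FlagClass σ n, (F.density G.out - φ.eval F) ^ 2 * φ.val n G =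
      ∑ G : FlagClass σ n, (F.density G.out * F.density G.out - F.pairDensity F G.out) *
        φ.val n G := by
    have e : ∀ G : FlagClass σ n, (F.density G.out - φ.eval F) ^ 2 * φ.val n G =
      (F.density G.out * F.density G.out - F.pairDensity F G.out) * φ.val n G +
      F.pairDensity F G.out * φ.val n G - 2 * φ.eval F * (F.density G.out * φ.val n G) +
      φ.eval F ^ 2 * φ.val n G := fun G => by ring
    simp only [e, sum_add_distrib, sum_sub_distrib, ← mul_sum]
    rw [← h1, ← h2, h3]
    ring
  rw [h4]
  calc _ ≤ ∑ G : FlagClass σ n, ε * φ.val n G := sum_le_sum fun G _ =>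
        mul_le_mul_of_nonneg_right ((le_abs_self _).trans (hn _)) (φ.nonneg _ _)
    _ = ε := by rw [← mul_sum, h3, mul_one]

/-- A union bound over the finitely many flags of order at most `i`: the expected total squared
deviation of their densities in a random flag falls below `ε²`, so some flag is good for all of them
at once. -/
theorem exists_density_close (φ : PosHom σ) (i : ℕ) {ε : ℝ} (hε : 0 < ε) :
    ∃ n, i ≤ n ∧ ∃ G : TFlag σ (Fin n), ∀ m ≤ i, ∀ F : TFlag σ (Fin m),
      |F.density G - φ.eval F| < ε := by
  let I := Σ m : Fin (i + 1), TFlag σ (Fin m)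
  have : Fintype I := Fintype.ofFinite _
  -- Chosen so that `Fintype.card I * δ < ε ^ 2`, strictly and even for empty `I`.
  set δ : ℝ := ε ^ 2 / (Fintype.card I + 1) with hδ
  have hδ0 : 0 < δ := by positivity
  have h : ∀ᶠ n in atTop, ∀ F : I,
      ∑ G : FlagClass σ n, (F.2.density G.out - φ.eval F.2) ^ 2 * φ.val n G ≤ δ :=
    eventually_all.2 fun F => φ.eventually_sum_sq_le F.2 hδ0
  obtain ⟨n, hn, hni⟩ := (h.and (eventually_ge_atTop (i + k))).exists
  refine ⟨n, by omega, ?_⟩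
  by_contra! hcon
  have h1 : ∀ G : FlagClass σ n,
      ε ^ 2 ≤ ∑ F : I, (F.2.density G.out - φ.eval F.2) ^ 2 := by
    intro G
    obtain ⟨m, hm, F, hF⟩ := hcon G.out
    refine le_trans ?_ (single_le_sum (f := fun F : I => (F.2.density G.out - φ.eval F.2) ^ 2)
      (fun _ _ => sq_nonneg _) (mem_univ (⟨⟨m, by omega⟩, F⟩ : I)))
    rw [← sq_abs (_ - _)]
    exact pow_le_pow_left₀ hε.le hF 2
  have h2 : ε ^ 2 ≤ ∑ G : FlagClass σ n, (∑ F : I, (F.2.density G.out - φ.eval F.2) ^ 2) *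
      φ.val n G := by
    calc ε ^ 2 = ∑ G : FlagClass σ n, ε ^ 2 * φ.val n G := by
          rw [← mul_sum, φ.sum_val (by omega), mul_one]
      _ ≤ _ := sum_le_sum fun G _ => mul_le_mul_of_nonneg_right (h1 G) (φ.nonneg _ _)
  simp only [sum_mul] at h2
  rw [sum_comm] at h2
  have h3 := h2.trans (sum_le_sum fun F _ => hn F)
  rw [sum_const, card_univ, nsmul_eq_mul, hδ, mul_div_assoc', le_div_iff₀ (by positivity)] at h3
  nlinarith [pow_pos hε 2]

/-- Every positive homomorphism is the limit of a sequence of tournaments. -/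
theorem exists_tendsto_density (φ : PosHom emptyType) :
    ∃ (N : ℕ → ℕ) (T : ∀ i, Tournament (Fin (N i))), (∀ i, i + 2 ≤ N i) ∧
      ∀ (m : ℕ) (F : TFlag emptyType (Fin m)),
        Tendsto (fun i => F.density (TFlag.ofTournament (T i))) atTop (𝓝 (φ.eval F)) := by
  -- Order at least `i + 2` makes the orders tend to infinity and leaves room for an arc in every `T
  -- i`.
  choose N hN G hG using fun i : ℕ =>
    φ.exists_density_close (i + 2) (ε := 1 / ((i : ℝ) + 1)) (by positivity)
  refine ⟨N, fun i => (G i).model, hN, fun m F => ?_⟩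
  rw [tendsto_iff_norm_sub_tendsto_zero]
  refine squeeze_zero' (Eventually.of_forall fun _ => norm_nonneg _) ?_
    tendsto_one_div_add_atTop_nhds_zero_nat
  filter_upwards [eventually_ge_atTop m] with i hi
  rw [TFlag.ofTournament_model]
  exact (hG i m (by omega) F).le

end PosHom

/-! ### Existence of the random extension. -/

/-- The embeddings of the type `σ` into the tournament `T`. -/
abbrev Tournament.Placement {k : ℕ} {V : Type*} (T : Tournament V) (σ : Tournament (Fin k)) :=
  {θ : Fin k ↪ V // ∀ i j, T.Adj (θ i) (θ j) ↔ σ.Adj i j}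

namespace TFlag

variable {k : ℕ} {σ : Tournament (Fin k)} {V W : Type*}

/-- The flag obtained from a tournament by labelling it. -/
def ofPlacement {T : Tournament V} (θ : T.Placement σ) : TFlag σ V := ⟨T, θ.1, θ.2⟩

theorem sum_density_placement [Fintype V] (T : Tournament V) {m : ℕ} (F : TFlag σ (Fin m))
    (hV : m ≤ Fintype.card V) :
    (∑ θ : T.Placement σ, F.density (ofPlacement θ)) / Fintype.card (Fin k ↪ V) =
      F.labelProb * (ofTournament F.model).density (ofTournament T) := by
  rw [← sum_density_label T F hV]
  congr 1
  rw [sum_dite, sum_const_zero, add_zero]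
  refine sum_bij' (fun θ _ => ⟨θ.1, mem_filter.2 ⟨mem_univ _, θ.2⟩⟩)
    (fun θ _ => ⟨θ.1, (mem_filter.1 θ.2).2⟩)
    ?_ ?_ ?_ ?_ ?_
  all_goals simp [ofPlacement]

theorem density_congr_left {m : ℕ} [Fintype V] {F F' : TFlag σ (Fin m)} (h : F.Iso F')
    (G : TFlag σ V) : F.density G = F'.density G := by
  unfold density
  congr! 4
  exact ⟨fun h' => h'.congr h, fun h' => h'.congr h.symm⟩

theorem density_out {m : ℕ} [Fintype V] (F : TFlag σ (Fin m)) (G : TFlag σ V) :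
    (Quotient.out (⟦F⟧ : FlagClass σ m)).density G = F.density G :=
  density_congr_left (Quotient.mk_out F) G

end TFlag

section Averages

variable {Θ : ℕ → Type*} [∀ i, Fintype (Θ i)] [∀ i, Nonempty (Θ i)]
  {X : Type*} [TopologicalSpace X] [CompactSpace X] [T2Space X] [MeasurableSpace X] [BorelSpace X]

/-- A sequence of finitely supported uniform measures on a compact space has a limit along every
ultrafilter. -/
theorem exists_probabilityMeasure_tendsto_average (U : Ultrafilter ℕ) (x : ∀ i, Θ i → X) :
    ∃ P : ProbabilityMeasure X, ∀ f : X → ℝ, Continuous f →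
      Tendsto (fun i => (∑ θ, f (x i θ)) / Fintype.card (Θ i)) U (𝓝 (∫ y, f y ∂(P : Measure X))) := by
  let μ : ∀ i, Measure X := fun i =>
    (Fintype.card (Θ i) : ENNReal)⁻¹ • ∑ θ : Θ i, Measure.dirac (x i θ)
  have hμ : ∀ i, IsProbabilityMeasure (μ i) := by
    intro i
    refine ⟨?_⟩
    simp only [μ, Measure.smul_apply, Measure.finsetSum_apply, measure_univ, sum_const, card_univ,
      nsmul_eq_mul, mul_one, smul_eq_mul]
    exact ENNReal.inv_mul_cancel (by simp) (by simp)
  let ν : ℕ → ProbabilityMeasure X := fun i => ⟨μ i, hμ i⟩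
  -- Probability measures on a compact Hausdorff space form a weakly compact space, so the
  -- ultrafilter has a limit there and no subsequence is needed.
  obtain ⟨P, -, hP⟩ := isCompact_univ.ultrafilter_le_nhds (U.map ν) (by simp)
  have hP' : Tendsto ν U (𝓝 P) := hP
  refine ⟨P, fun f hf => ?_⟩
  have := ProbabilityMeasure.tendsto_iff_forall_integral_tendsto.1 hP'
    (BoundedContinuousFunction.mkOfCompact ⟨f, hf⟩)
  refine this.congr fun i => ?_
  have hint : ∀ θ : Θ i, Integrable f (Measure.dirac (x i θ)) := fun θ =>
    (integrable_dirac (by simp))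
  simp only [ProbabilityMeasure.coe_mk, BoundedContinuousFunction.mkOfCompact_apply,
    ContinuousMap.coe_mk, ν, μ]
  rw [integral_smul_measure, integral_finsetSum_measure fun θ _ => hint θ]
  simp only [integral_dirac, ENNReal.toReal_inv, ENNReal.toReal_natCast, smul_eq_mul]
  rw [div_eq_inv_mul]

end Averages

namespace PosHom

variable {k : ℕ} {σ : Tournament (Fin k)}

theorem measurable_eval {n : ℕ} (F : TFlag σ (Fin n)) :
    Measurable fun ψ : PosHom σ => ψ.eval F := by
  have h : Measurable (PosHom.val : PosHom σ → _) := comap_measurable _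
  exact (measurable_pi_apply _).comp ((measurable_pi_apply n).comp h)

theorem integrable_eval (P : ProbabilityMeasure (PosHom σ)) {n : ℕ} (F : TFlag σ (Fin n)) :
    Integrable (fun ψ : PosHom σ => ψ.eval F) (P : Measure (PosHom σ)) :=
  Integrable.of_bound (measurable_eval F).aestronglyMeasurable 1 (Eventually.of_forall fun ψ => by
    rw [Real.norm_of_nonneg (ψ.eval_nonneg F)]
    exact ψ.eval_le_one F)

/-- If `T i` converges to `φ`, then the average density of `F` over all placements of the labels
converges to the expectation of the random extension. -/
theorem tendsto_average_density (φ : PosHom emptyType) (hφ : φ.evalDown (TFlag.unit σ) ≠ 0)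
    {N : ℕ → ℕ} {T : ∀ i, Tournament (Fin (N i))} (hN : Tendsto N atTop atTop)
    (hT : ∀ (m : ℕ) (F : TFlag emptyType (Fin m)),
      Tendsto (fun i => F.density (TFlag.ofTournament (T i))) atTop (𝓝 (φ.eval F)))
    {n : ℕ} (F : TFlag σ (Fin n)) :
    Tendsto (fun i => (∑ θ : (T i).Placement σ, F.density (TFlag.ofPlacement θ)) /
      Fintype.card ((T i).Placement σ)) atTop
      (𝓝 (φ.evalDown F / φ.evalDown (TFlag.unit σ))) := by
  have key : ∀ {m : ℕ} (F : TFlag σ (Fin m)), Tendsto (fun i =>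
      (∑ θ : (T i).Placement σ, F.density (TFlag.ofPlacement θ)) /
        Fintype.card (Fin k ↪ Fin (N i))) atTop (𝓝 (φ.evalDown F)) := by
    intro m F
    refine ((hT m (TFlag.ofTournament F.model)).const_mul F.labelProb).congr' ?_
    filter_upwards [hN.eventually_ge_atTop m] with i hi
    rw [TFlag.sum_density_placement (T i) F (by simpa using hi)]
  -- The unit has density `1`, so its average is the proportion of injections that are placements.
  -- Dividing by it turns averages over injections into averages over placements.
  refine ((key F).div (key (TFlag.unit σ)) hφ).congr' ?_
  filter_upwards [hN.eventually_ge_atTop k] with i hi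
  have h0 : (Fintype.card (Fin k ↪ Fin (N i)) : ℝ) ≠ 0 := by
    have : Nonempty (Fin k ↪ Fin (N i)) := ⟨Fin.castLEEmb hi⟩
    exact_mod_cast Fintype.card_ne_zero
  simp only [Pi.div_apply, TFlag.density_unit, sum_const, card_univ, nsmul_eq_mul, mul_one]
  rw [div_div_div_cancel_right₀ h0]

/-- The vectors of values in `[0, 1]` on all classes of flags. -/
abbrev ValueCube {k : ℕ} (σ : Tournament (Fin k)) := ∀ _ : Σ n, FlagClass σ n, Set.Icc (0 : ℝ) 1

/-- The vector of densities in a flag. -/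
noncomputable def densityVector {V : Type*} [Fintype V] (G : TFlag σ V) : ValueCube σ :=
  fun p => ⟨p.2.out.density G, TFlag.density_nonneg _ _, TFlag.density_le_one _ _⟩

/-- The vectors of values of positive homomorphisms. -/
def IsHomVector (x : ValueCube σ) : Prop :=
  (x ⟨k, ⟦TFlag.unit σ⟧⟩ : ℝ) = 1 ∧
  (∀ m ℓ (F₁ : TFlag σ (Fin m)), m ≤ ℓ →
    (x ⟨m, ⟦F₁⟧⟩ : ℝ) = ∑ F : FlagClass σ ℓ, F₁.density F.out * x ⟨ℓ, F⟩) ∧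
  ∀ m₁ m₂ ℓ (F₁ : TFlag σ (Fin m₁)) (F₂ : TFlag σ (Fin m₂)), ℓ + k = m₁ + m₂ →
    (x ⟨m₁, ⟦F₁⟧⟩ * x ⟨m₂, ⟦F₂⟧⟩ : ℝ) =
      ∑ F : FlagClass σ ℓ, F₁.pairDensity F₂ F.out * x ⟨ℓ, F⟩

/-- The positive homomorphism with a given vector of values. -/
def ofVector (x : ValueCube σ) (hx : IsHomVector x) : PosHom σ where
  val n F := x ⟨n, F⟩
  nonneg n F := (x ⟨n, F⟩).2.1
  one := hx.1
  chain := hx.2.1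
  mul := hx.2.2

theorem continuous_coord (p : Σ n, FlagClass σ n) : Continuous fun x : ValueCube σ => (x p : ℝ) :=
  continuous_subtype_val.comp (continuous_apply p)

/-- A continuous function with nonnegative values and asymptotically vanishing averages vanishes
almost surely in the limit. -/
theorem ae_eq_zero_of_tendsto_average {X : Type*} [TopologicalSpace X] [CompactSpace X]
    [MeasurableSpace X] [BorelSpace X] {U : Ultrafilter ℕ} {Θ : ℕ → Type*} [∀ i, Fintype (Θ i)]
    [∀ i, Nonempty (Θ i)] {x : ∀ i, Θ i → X} {P : ProbabilityMeasure X} {f : X → ℝ}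
    (hf : Continuous f) (hf0 : ∀ y, 0 ≤ f y)
    (hlim : Tendsto (fun i => (∑ θ, f (x i θ)) / Fintype.card (Θ i)) U
      (𝓝 (∫ y, f y ∂(P : Measure X))))
    (h : ∀ ε > 0, ∀ᶠ i in U, ∀ θ, f (x i θ) ≤ ε) : ∀ᵐ y ∂(P : Measure X), f y = 0 := by
  have h0 : ∫ y, f y ∂(P : Measure X) = 0 := by
    refine le_antisymm (le_of_forall_pos_le_add fun ε hε => ?_) (integral_nonneg hf0)
    rw [zero_add]
    refine le_of_tendsto hlim ((h ε hε).mono fun i hi => ?_)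
    have : (0 : ℝ) < Fintype.card (Θ i) := by exact_mod_cast Fintype.card_pos
    rw [div_le_iff₀ this]
    calc ∑ θ, f (x i θ) ≤ ∑ _θ : Θ i, ε := sum_le_sum fun θ _ => hi θ
      _ = ε * Fintype.card (Θ i) := by simp [mul_comm]
  obtain ⟨C, hC⟩ := isCompact_univ.exists_bound_of_continuousOn hf.continuousOn
  have hint : Integrable f (P : Measure X) :=
    Integrable.of_bound hf.measurable.aestronglyMeasurable C
      (Eventually.of_forall fun y => hC y (Set.mem_univ y))
  exact (integral_eq_zero_iff_of_nonneg hf0 hint).1 h0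

/-- The unit and chain relations hold exactly in every sufficiently large flag, the product relation
up to an error uniform over all flags. Each is an equality of continuous functions on the cube, and
there are countably many of them, so all hold almost surely in the limit. -/
theorem ae_isHomVector {U : Ultrafilter ℕ} (hU : (U : Filter ℕ) ≤ atTop) {N : ℕ → ℕ}
    (hN : Tendsto N atTop atTop) {Θ : ℕ → Type*} [∀ i, Fintype (Θ i)]
    [∀ i, Nonempty (Θ i)] (G : ∀ i, Θ i → TFlag σ (Fin (N i)))
    {P : ProbabilityMeasure (ValueCube σ)}
    (hP : ∀ f : ValueCube σ → ℝ, Continuous f →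
      Tendsto (fun i => (∑ θ, f (densityVector (G i θ))) / Fintype.card (Θ i)) U
        (𝓝 (∫ y, f y ∂(P : Measure (ValueCube σ))))) :
    ∀ᵐ x ∂(P : Measure (ValueCube σ)), IsHomVector x := by
  have hNU : Tendsto N U atTop := hN.mono_left hU
  have hc := continuous_coord (σ := σ)
  have key : ∀ f g : ValueCube σ → ℝ, Continuous f → Continuous g →
      (∀ ε > 0, ∀ᶠ i in U, ∀ θ, |f (densityVector (G i θ)) - g (densityVector (G i θ))| ≤ ε) →
      ∀ᵐ x ∂(P : Measure (ValueCube σ)), f x = g x := by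
    intro f g hf hg h
    have h1 : Continuous fun x => |f x - g x| := (hf.sub hg).abs
    filter_upwards [ae_eq_zero_of_tendsto_average h1 (fun _ => abs_nonneg _) (hP _ h1) h] with x hx
    exact sub_eq_zero.1 (abs_eq_zero.1 hx)
  refine (key _ _ (hc _) continuous_const fun ε hε => Eventually.of_forall fun i θ => ?_).and
    ((ae_all_iff.2 fun m => ae_all_iff.2 fun ℓ => ae_all_iff.2 fun F₁ => ae_all_iff.2 fun h =>
      key _ _ (hc _) (continuous_finsetSum _ fun F _ => (hc _).const_mul _) fun ε hε => ?_).and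
    (ae_all_iff.2 fun m₁ => ae_all_iff.2 fun m₂ => ae_all_iff.2 fun ℓ => ae_all_iff.2 fun F₁ =>
      ae_all_iff.2 fun F₂ => ae_all_iff.2 fun h =>
      key _ _ ((hc _).mul (hc _)) (continuous_finsetSum _ fun F _ => (hc _).const_mul _)
        fun ε hε => ?_))
  · simp only [densityVector, TFlag.density_out, TFlag.density_unit, sub_self, abs_zero]
    exact hε.le
  · filter_upwards [hNU.eventually_ge_atTop ℓ] with i hi θ
    simp only [densityVector, TFlag.density_out]
    rw [TFlag.density_chain (G i θ) F₁ h (by simpa using hi), sub_self, abs_zero]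
    exact hε.le
  · filter_upwards [hNU.eventually
      (TFlag.eventually_abs_density_mul_sub_pairDensity_le F₁ F₂ hε)] with i hi θ
    simp only [densityVector, TFlag.density_out]
    rw [← TFlag.pairDensity_chain (G i θ) F₁ F₂ h]
    exact hi _

/-- The random extension exists as soon as the type occurs with positive density. -/
theorem exists_isExtension (φ : PosHom emptyType) (hφ : φ.evalDown (TFlag.unit σ) ≠ 0)
    {N : ℕ → ℕ} {T : ∀ i, Tournament (Fin (N i))} (hN : Tendsto N atTop atTop)
    (hT : ∀ (m : ℕ) (F : TFlag emptyType (Fin m)),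
      Tendsto (fun i => F.density (TFlag.ofTournament (T i))) atTop (𝓝 (φ.eval F)))
    (hne : ∀ i, Nonempty ((T i).Placement σ)) :
    ∃ P : ProbabilityMeasure (PosHom σ), IsExtension φ P := by
  let U : Ultrafilter ℕ := hyperfilter ℕ
  have hU : (U : Filter ℕ) ≤ atTop := Nat.hyperfilter_le_atTop
  obtain ⟨P, hP⟩ := exists_probabilityMeasure_tendsto_average U
    (fun i (θ : (T i).Placement σ) => densityVector (TFlag.ofPlacement θ))
  have hae := ae_isHomVector hU hN (fun i (θ : (T i).Placement σ) => TFlag.ofPlacement θ) hP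
  obtain ⟨x₀, hx₀⟩ := hae.exists
  -- Measurability of the set of homomorphism vectors is bypassed: its complement is enlarged to a
  -- measurable null set `t`, on which `g` takes the fixed value given by `x₀`.
  obtain ⟨t, hst, htm, ht0⟩ := exists_measurable_superset_of_null (ae_iff.1 hae)
  have ht : ∀ x, x ∉ t → IsHomVector x := fun x hx => by
    by_contra h
    exact hx (hst h)
  let g : ValueCube σ → PosHom σ := fun x =>
    if h : x ∈ t then ofVector x₀ hx₀ else ofVector x (ht x h)
  have hg : Measurable g := by
    refine measurable_comap_iff.2 (measurable_pi_lambda _ fun n => measurable_pi_lambda _ fun F => ?_)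
    have : (fun x => (PosHom.val ∘ g) x n F) =
        fun x => if x ∈ t then (x₀ ⟨n, F⟩ : ℝ) else x ⟨n, F⟩ := by
      ext x
      simp only [Function.comp, g]
      split_ifs <;> rfl
    rw [this]
    exact Measurable.ite htm measurable_const (continuous_coord _).measurable
  refine ⟨P.map hg.aemeasurable, fun n F => ?_⟩
  have h1 : ∫ ψ, ψ.eval F ∂((P.map hg.aemeasurable : ProbabilityMeasure _) : Measure (PosHom σ)) =
      ∫ x, (x ⟨n, ⟦F⟧⟩ : ℝ) ∂(P : Measure (ValueCube σ)) := by
    rw [ProbabilityMeasure.toMeasure_map, integral_map hg.aemeasurable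
      (measurable_eval F).aestronglyMeasurable]
    refine integral_congr_ae ?_
    filter_upwards [measure_eq_zero_iff_ae_notMem.1 ht0] with x hx
    simp only [g, dif_neg hx]
    rfl
  rw [h1]
  -- The averages of the density of `F` converge along `U` both to the integral and to the value
  -- demanded of the extension.
  refine tendsto_nhds_unique (hP _ (continuous_coord _)) ?_
  simp only [densityVector, TFlag.density_out]
  exact (φ.tendsto_average_density hφ hN hT F).mono_left hU

/-- All tournaments on two vertices are isomorphic, so `φ` takes the value `1` there, and the
identity labelling makes `labelProb` positive. -/
theorem evalDown_unit_arcType_ne_zero (φ : PosHom emptyType) :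
    φ.evalDown (TFlag.unit arcType) ≠ 0 := by
  have h1 : ∀ G : TFlag emptyType (Fin 2), (TFlag.ofTournament arcType).Iso G := by
    intro G
    have hG := G.model.adj_iff 0 1 (by decide)
    have i0 := G.model.irrefl 0
    have i1 := G.model.irrefl 1
    by_cases h : G.model.Adj 0 1
    · refine ⟨Equiv.refl _, fun u v => ?_, fun i => i.elim0⟩
      fin_cases u <;> fin_cases v <;>
        simp [TFlag.ofTournament, arcType, transTournament, h, hG.1 h, i0, i1]
    · refine ⟨Equiv.swap 0 1, fun u v => ?_, fun i => i.elim0⟩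
      have h' : G.model.Adj 1 0 := by
        by_contra h'
        exact h (hG.2 h')
      fin_cases u <;> fin_cases v <;>
        simp [TFlag.ofTournament, arcType, transTournament, h, h', i0, i1]
  have h2 : φ.eval (TFlag.ofTournament (TFlag.unit arcType).model) = 1 := by
    rw [← φ.sum_val (n := 2) (by omega), sum_eq_single ⟦TFlag.ofTournament arcType⟧]
    · rfl
    · intro F _ hF
      exact absurd ((Quotient.out_eq F).symm.trans (Quotient.sound (h1 F.out).symm)) hF
    · simp
  rw [evalDown, h2, mul_one, TFlag.labelProb]
  refine div_ne_zero ?_ ?_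
  · rw [Nat.cast_ne_zero, ← Nat.pos_iff_ne_zero, card_pos]
    refine ⟨Function.Embedding.refl _, ?_⟩
    simp only [mem_filter, mem_univ, true_and]
    exact ⟨fun i j => Iff.rfl, TFlag.Iso.refl _⟩
  · have : Nonempty (Fin 2 ↪ Fin 2) := ⟨Function.Embedding.refl _⟩
    exact_mod_cast Fintype.card_ne_zero

end PosHom

/-! ### The flag `Tr_3^A` and its second moment. -/

theorem arcType_adj {i j : Fin 2} : arcType.Adj i j ↔ i < j := Iff.rfl

theorem Tournament.ne_of_adj {V : Type*} (T : Tournament V) {u v : V} (h : T.Adj u v) : u ≠ v := by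
  rintro rfl
  exact T.irrefl _ h

theorem Tournament.not_adj_of_adj {V : Type*} (T : Tournament V) {u v : V} (h : T.Adj u v) :
    ¬ T.Adj v u := (T.adj_iff u v (T.ne_of_adj h)).1 h

theorem Tournament.adj_of_not_adj {V : Type*} (T : Tournament V) {u v : V} (hne : u ≠ v)
    (h : ¬ T.Adj u v) : T.Adj v u := (T.adj_iff v u hne.symm).2 h

theorem Tournament.Placement.adj {V : Type*} {T : Tournament V} (θ : T.Placement arcType) :
    T.Adj (θ.1 0) (θ.1 1) := (θ.2 0 1).2 (by rw [arcType_adj]; decide)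

theorem Tournament.exists_placement {V : Type*} (T : Tournament V) {u v : V} (h : T.Adj u v) :
    ∃ θ : T.Placement arcType, θ.1 0 = u ∧ θ.1 1 = v := by
  have hne := T.ne_of_adj h
  have hn := T.not_adj_of_adj h
  obtain ⟨e, e0, e1⟩ : ∃ e : Fin 2 ↪ V, e 0 = u ∧ e 1 = v := ⟨⟨![u, v], fun i j => by
    fin_cases i <;> fin_cases j <;> simp [hne, hne.symm]⟩, rfl, rfl⟩
  refine ⟨⟨e, fun i j => ?_⟩, e0, e1⟩
  fin_cases i <;> fin_cases j <;> simp [arcType_adj, h, hn, e0, e1, T.irrefl]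

theorem TFlag.induces_trA_iff {V : Type*} [DecidableEq V] {T : Tournament V} (θ : T.Placement arcType)
    {S : Finset V} : (ofPlacement θ).Induces S trA ↔
      ∃ w, T.Adj (θ.1 0) w ∧ T.Adj w (θ.1 1) ∧ S = {θ.1 0, w, θ.1 1} := by
  rw [induces_iff_exists_isEmb]
  constructor
  · rintro ⟨e, rfl, he, hl⟩
    have h0 : e 0 = θ.1 0 := hl 0
    have h2 : e 2 = θ.1 1 := hl 1
    refine ⟨e 1, ?_, ?_, ?_⟩
    · rw [← h0]
      exact (he 0 1).2 (show (0 : Fin 3) < 1 by decide)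
    · rw [← h2]
      exact (he 1 2).2 (show (1 : Fin 3) < 2 by decide)
    · rw [← h0, ← h2]
      ext x
      simp [Fin.exists_fin_succ, eq_comm]
  · rintro ⟨w, h1, h2, rfl⟩
    have h3 := θ.adj
    have n1 := T.ne_of_adj h1
    have n2 := T.ne_of_adj h2
    have n3 := T.ne_of_adj h3
    obtain ⟨e, e0, e1, e2⟩ : ∃ e : Fin 3 ↪ V, e 0 = θ.1 0 ∧ e 1 = w ∧ e 2 = θ.1 1 :=
      ⟨⟨![θ.1 0, w, θ.1 1], fun i j => by
        fin_cases i <;> fin_cases j <;> simp [n1, n2, n3, n1.symm, n2.symm, n3.symm]⟩,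
        rfl, rfl, rfl⟩
    refine ⟨e, ?_, fun i j => ?_, fun i => ?_⟩
    · ext x
      simp [Fin.exists_fin_succ, e0, e1, e2, eq_comm]
    · have m1 := T.not_adj_of_adj h1
      have m2 := T.not_adj_of_adj h2
      have m3 := T.not_adj_of_adj h3
      fin_cases i <;> fin_cases j <;>
        simp [ofPlacement, trA, transTournament, e0, e1, e2, h1, h2, h3, m1, m2, m3, T.irrefl]
    · fin_cases i
      · exact e0
      · exact e2

/-- A three-set containing the arc is given by its third vertex. For `n = 2` both denominators are
zero, so the identity persists. -/
theorem TFlag.density_trA {n : ℕ} {T : Tournament (Fin n)} (θ : T.Placement arcType) :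
    trA.density (ofPlacement θ) = transRatio T (θ.1 0) (θ.1 1) := by
  have hn : 2 ≤ n := by simpa using (ofPlacement θ).le_card
  rw [density, card_extSets _ (by omega), transRatio, Fintype.card_fin]
  congr 1
  · norm_cast
    symm
    refine card_bij (fun w _ => {θ.1 0, w, θ.1 1}) ?_ ?_ ?_
    · intro w hw
      simp only [mem_filter, mem_univ, true_and] at hw
      have hi := (induces_trA_iff θ).2 ⟨w, hw.1, hw.2, rfl⟩
      simp only [extSets, mem_filter, mem_univ, true_and]
      exact ⟨⟨hi.1, by simpa using hi.card_eq⟩, hi⟩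
    · intro w hw w' hw' h
      simp only [mem_filter, mem_univ, true_and] at hw
      have : w ∈ ({θ.1 0, w', θ.1 1} : Finset (Fin n)) := by
        rw [← h]
        simp
      simpa [(T.ne_of_adj hw.1).symm, T.ne_of_adj hw.2] using this
    · intro S hS
      obtain ⟨w, h1, h2, rfl⟩ := (induces_trA_iff θ).1 (mem_filter.1 hS).2
      exact ⟨w, by simp [h1, h2], rfl⟩
  · simp [Nat.cast_sub hn]

namespace PosHom

/-- The second moment of `φ^A(Tr_3^A) - 1/4` is the limit of second moments along a convergent
sequence of tournaments. -/
theorem tendsto_average_sq_transRatio (φ : PosHom emptyType) {P : ProbabilityMeasure (PosHom arcType)}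
    (hP : IsExtension φ P) {N : ℕ → ℕ} {T : ∀ i, Tournament (Fin (N i))}
    (hN : Tendsto N atTop atTop)
    (hT : ∀ (m : ℕ) (F : TFlag emptyType (Fin m)),
      Tendsto (fun i => F.density (TFlag.ofTournament (T i))) atTop (𝓝 (φ.eval F)))
    (hne : ∀ i, Nonempty ((T i).Placement arcType)) :
    Tendsto (fun i : ℕ => (∑ θ : (T i).Placement arcType,
      (transRatio (T i) (θ.1 0) (θ.1 1) - 1 / 4) ^ 2 : ℝ) /
        (Fintype.card ((T i).Placement arcType) : ℝ)) atTop (𝓝 (∫ ψ, (ψ.eval trA - 1 / 4) ^ 2 ∂(P : Measure (PosHom arcType)))) := by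
  have hlim : ∀ {n : ℕ} (F : TFlag arcType (Fin n)), Tendsto (fun i =>
      (∑ θ : (T i).Placement arcType, F.density (TFlag.ofPlacement θ)) /
        Fintype.card ((T i).Placement arcType)) atTop
      (𝓝 (∫ ψ, ψ.eval F ∂(P : Measure (PosHom arcType)))) := fun F => by
    rw [hP]
    exact φ.tendsto_average_density φ.evalDown_unit_arcType_ne_zero hN hT F
  -- The square is a fixed linear combination of values on flags of order `3 + 3 - 2 = 4`, so
  -- `IsExtension` determines its expectation.
  have hmul : ∀ ψ : PosHom arcType, ψ.eval trA ^ 2 =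
      ∑ F : FlagClass arcType 4, trA.pairDensity trA F.out * ψ.eval F.out := fun ψ => by
    rw [sq, ψ.eval_mul_eval trA trA (ℓ := 4) rfl le_rfl]
    simp only [eval_out]
  have hint2 : Integrable (fun ψ : PosHom arcType => ψ.eval trA ^ 2)
      (P : Measure (PosHom arcType)) := by
    simp only [hmul]
    exact integrable_finsetSum _ fun F _ => (integrable_eval P _).const_mul _
  have hpair : Tendsto (fun i => (∑ θ : (T i).Placement arcType,
      trA.pairDensity trA (TFlag.ofPlacement θ)) / Fintype.card ((T i).Placement arcType)) atTop
      (𝓝 (∫ ψ, ψ.eval trA ^ 2 ∂(P : Measure (PosHom arcType)))) := by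
    simp only [hmul]
    rw [integral_finsetSum _ fun F _ => (integrable_eval P _).const_mul _]
    simp only [integral_const_mul]
    refine (tendsto_finsetSum univ fun (F : FlagClass arcType 4) _ =>
      (hlim F.out).const_mul (trA.pairDensity trA F.out)).congr fun i => ?_
    rw [sum_congr rfl fun θ _ => TFlag.pairDensity_chain (TFlag.ofPlacement θ) trA trA
      (show 4 + 2 = 3 + 3 from rfl), sum_comm, sum_div]
    refine sum_congr rfl fun F _ => ?_
    rw [← mul_sum, mul_div_assoc]
  -- The joint density differs from the squared density by an error uniform over placements, so the
  -- two averages have the same limit.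
  have hsq : Tendsto (fun i => (∑ θ : (T i).Placement arcType,
      trA.density (TFlag.ofPlacement θ) ^ 2) / Fintype.card ((T i).Placement arcType)) atTop
      (𝓝 (∫ ψ, ψ.eval trA ^ 2 ∂(P : Measure (PosHom arcType)))) := by
    refine (tendsto_iff_of_dist ?_).1 hpair
    rw [Metric.tendsto_nhds]
    intro ε hε
    filter_upwards [hN.eventually (TFlag.eventually_abs_density_mul_sub_pairDensity_le trA trA
      (half_pos hε))] with i hi
    have hc : (0 : ℝ) < Fintype.card ((T i).Placement arcType) := by
      exact_mod_cast Fintype.card_pos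
    rw [Real.dist_0_eq_abs, abs_of_nonneg dist_nonneg, dist_comm, Real.dist_eq, ← sub_div,
      ← sum_sub_distrib, abs_div, abs_of_pos hc]
    refine lt_of_le_of_lt ?_ (half_lt_self hε)
    rw [div_le_iff₀ hc]
    calc _ ≤ ∑ θ : (T i).Placement arcType, |trA.density (TFlag.ofPlacement θ) ^ 2 -
          trA.pairDensity trA (TFlag.ofPlacement θ)| := abs_sum_le_sum_abs _ _
      _ ≤ ∑ _θ : (T i).Placement arcType, ε / 2 := sum_le_sum fun θ _ => by
          rw [sq]
          exact hi _
      _ = _ := by simp [mul_comm]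
  have h1 : ∫ ψ, (ψ.eval trA - 1 / 4) ^ 2 ∂(P : Measure (PosHom arcType)) =
      ∫ ψ, ψ.eval trA ^ 2 ∂(P : Measure (PosHom arcType)) -
        1 / 2 * ∫ ψ, ψ.eval trA ∂(P : Measure (PosHom arcType)) + 1 / 16 := by
    have e : ∀ ψ : PosHom arcType, (ψ.eval trA - 1 / 4) ^ 2 =
        ψ.eval trA ^ 2 - 1 / 2 * ψ.eval trA + 1 / 16 := fun ψ => by ring
    simp only [e]
    rw [integral_add (f := fun ψ : PosHom arcType => ψ.eval trA ^ 2 - 1 / 2 * ψ.eval trA)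
      (g := fun _ => 1 / 16) (hint2.sub ((integrable_eval P _).const_mul _)) (integrable_const _),
      integral_sub hint2 ((integrable_eval P _).const_mul _), integral_const_mul]
    simp
  rw [h1]
  refine ((hsq.sub ((hlim trA).const_mul (1 / 2))).add_const (1 / 16)).congr fun i => ?_
  have hc : (Fintype.card ((T i).Placement arcType) : ℝ) ≠ 0 := by
    exact_mod_cast Fintype.card_ne_zero
  simp only [← TFlag.density_trA]
  have e : ∀ θ : (T i).Placement arcType, (trA.density (TFlag.ofPlacement θ) - 1 / 4) ^ 2 =
      trA.density (TFlag.ofPlacement θ) ^ 2 - 1 / 2 * trA.density (TFlag.ofPlacement θ) + 1 / 16 :=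
    fun θ => by ring
  simp only [e, sum_add_distrib, sum_sub_distrib, ← mul_sum, sum_const, card_univ, nsmul_eq_mul]
  field_simp

/-- Replaces the almost sure statement by a single number, which can be computed as a limit over
finite tournaments. -/
theorem ae_eval_trA_eq_iff (P : ProbabilityMeasure (PosHom arcType)) :
    (∀ᵐ ψ ∂(P : Measure (PosHom arcType)), ψ.eval trA = 1 / 4) ↔
      ∫ ψ, (ψ.eval trA - 1 / 4) ^ 2 ∂(P : Measure (PosHom arcType)) = 0 := by
  have hm : Measurable fun ψ : PosHom arcType => (ψ.eval trA - 1 / 4) ^ 2 :=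
    ((measurable_eval trA).sub_const _).pow_const 2
  have hint : Integrable (fun ψ : PosHom arcType => (ψ.eval trA - 1 / 4) ^ 2)
      (P : Measure (PosHom arcType)) :=
    Integrable.of_bound hm.aestronglyMeasurable 1 (Eventually.of_forall fun ψ => by
      have h0 := ψ.eval_nonneg trA
      have h1 := ψ.eval_le_one trA
      rw [Real.norm_of_nonneg (sq_nonneg _)]
      nlinarith)
  rw [integral_eq_zero_iff_of_nonneg (fun _ => sq_nonneg _) hint]
  refine eventually_congr (Eventually.of_forall fun ψ => ?_)
  simp [sub_eq_zero]

end PosHom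

/-! ### The sign matrix, scores and codegrees. -/

namespace Tournament

variable {V : Type*} (T : Tournament V)

/-- The skew-symmetric sign matrix of a tournament. -/
noncomputable def sign (u v : V) : ℝ := if T.Adj u v then 1 else if T.Adj v u then -1 else 0

theorem sign_of_adj {u v : V} (h : T.Adj u v) : T.sign u v = 1 := if_pos h

theorem sign_of_adj' {u v : V} (h : T.Adj v u) : T.sign u v = -1 := by
  rw [sign, if_neg (T.not_adj_of_adj h), if_pos h]

theorem sign_self (u : V) : T.sign u u = 0 := by simp [sign, T.irrefl]

theorem adj_trichotomy (u v : V) : u = v ∨ T.Adj u v ∨ T.Adj v u := by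
  by_cases h : u = v
  · exact Or.inl h
  · by_cases h' : T.Adj u v
    · exact Or.inr (Or.inl h')
    · exact Or.inr (Or.inr (T.adj_of_not_adj h h'))

theorem sign_swap (u v : V) : T.sign v u = -T.sign u v := by
  rcases T.adj_trichotomy u v with rfl | h | h
  · simp [sign_self]
  · rw [T.sign_of_adj h, T.sign_of_adj' h]
  · rw [T.sign_of_adj h, T.sign_of_adj' h, neg_neg]

theorem abs_sign_le (u v : V) : |T.sign u v| ≤ 1 := by
  unfold sign
  split_ifs <;> simp

theorem sign_sq (u v : V) : T.sign u v * T.sign u v = 1 - if u = v then 1 else 0 := by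
  rcases T.adj_trichotomy u v with rfl | h | h
  · simp [sign_self]
  · simp [T.sign_of_adj h, T.ne_of_adj h]
  · simp [T.sign_of_adj' h, (T.ne_of_adj h).symm]

theorem ite_adj_sub (u v : V) :
    (if T.Adj u v then (1 : ℝ) else 0) - (if T.Adj v u then 1 else 0) = T.sign u v := by
  rcases T.adj_trichotomy u v with rfl | h | h
  · simp [sign_self]
  · simp [T.sign_of_adj h, h, T.not_adj_of_adj h]
  · simp [T.sign_of_adj' h, h, T.not_adj_of_adj h]

theorem ite_adj_add (u v : V) :
    (if T.Adj u v then (1 : ℝ) else 0) + (if T.Adj v u then 1 else 0) =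
      1 - if u = v then 1 else 0 := by
  rcases T.adj_trichotomy u v with rfl | h | h
  · simp [T.irrefl]
  · simp [h, T.not_adj_of_adj h, T.ne_of_adj h]
  · simp [h, T.not_adj_of_adj h, (T.ne_of_adj h).symm]

variable [Fintype V]

/-- The difference of the out-degree and the in-degree. -/
noncomputable def score (u : V) : ℝ := ∑ v, T.sign u v

/-- The inner product of two rows of the sign matrix. -/
noncomputable def codeg (u v : V) : ℝ := ∑ w, T.sign u w * T.sign v w

/-- The set of arcs. -/
noncomputable def arcs : Finset (V × V) := {a | T.Adj a.1 a.2}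

theorem mem_arcs {a : V × V} : a ∈ T.arcs ↔ T.Adj a.1 a.2 := by simp [arcs]

theorem codeg_comm (u v : V) : T.codeg u v = T.codeg v u :=
  sum_congr rfl fun _ _ => mul_comm _ _

theorem codeg_self (u : V) : T.codeg u u = Fintype.card V - 1 := by
  simp [codeg, sign_sq]

/-- For fixed `w` the double sum is the square of a column sum, which by skew-symmetry is minus the
score of `w`. -/
theorem sum_codeg : ∑ u, ∑ v, T.codeg u v = ∑ u, T.score u ^ 2 := by
  have h : ∀ w, ∑ v, ∑ u, T.sign u w * T.sign v w = T.score w ^ 2 := by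
    intro w
    have : T.score w = -∑ u, T.sign u w := by
      rw [score, ← sum_neg_distrib]
      exact sum_congr rfl fun u _ => T.sign_swap u w
    rw [this, neg_sq, sq, sum_mul_sum, sum_comm]
  simp only [codeg, ← h]
  calc _ = ∑ v, ∑ u, ∑ w, T.sign u w * T.sign v w := sum_comm
    _ = ∑ v, ∑ w, ∑ u, T.sign u w * T.sign v w := sum_congr rfl fun v _ => sum_comm
    _ = _ := sum_comm

theorem sum_arcs (f : V → V → ℝ) :
    ∑ a ∈ T.arcs, f a.1 a.2 = ∑ u, ∑ v, (if T.Adj u v then 1 else 0) * f u v := by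
  rw [arcs, sum_filter, ← univ_product_univ, sum_product]
  simp

/-- The value `f u` is counted once for each arc leaving `u` and with a minus sign for each arc
entering `u`. -/
theorem sum_arcs_sub (f : V → ℝ) : ∑ a ∈ T.arcs, (f a.1 - f a.2) = ∑ u, f u * T.score u := by
  rw [T.sum_arcs fun u v => f u - f v]
  simp only [mul_sub, sum_sub_distrib]
  nth_rewrite 2 [sum_comm]
  rw [← sum_sub_distrib]
  refine sum_congr rfl fun u _ => ?_
  rw [← sum_sub_distrib, score, mul_sum]
  refine sum_congr rfl fun v _ => ?_
  rw [← sub_mul, ite_adj_sub, mul_comm]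

theorem two_mul_sum_arcs (f : V → V → ℝ) (hf : ∀ u v, f u v = f v u) :
    2 * ∑ a ∈ T.arcs, f a.1 a.2 = ∑ u, ∑ v, f u v - ∑ u, f u u := by
  rw [two_mul, T.sum_arcs]
  nth_rewrite 2 [sum_comm]
  rw [← sum_add_distrib, ← sum_sub_distrib]
  refine sum_congr rfl fun u _ => ?_
  rw [← sum_add_distrib]
  have : ∀ v, (if T.Adj u v then 1 else 0) * f u v + (if T.Adj v u then 1 else 0) * f v u =
      f u v - if u = v then f u v else 0 := by
    intro v
    rw [hf v u, ← add_mul, ite_adj_add]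
    split_ifs <;> ring
  simp only [this, sum_sub_distrib]
  simp

theorem two_mul_card_arcs :
    2 * (#T.arcs : ℝ) = Fintype.card V * (Fintype.card V - 1) := by
  have := T.two_mul_sum_arcs (fun _ _ => 1) (fun _ _ => rfl)
  simp only [sum_const, card_univ, nsmul_eq_mul, mul_one] at this
  rw [this]
  ring

theorem card_arcs_le : (#T.arcs : ℝ) ≤ (Fintype.card V : ℝ) ^ 2 := by
  have := T.two_mul_card_arcs
  have h : (0 : ℝ) ≤ Fintype.card V := Nat.cast_nonneg _
  nlinarith

/-- Away from `u` and `v`, four times the indicator of `u → w → v` is `(1 + sign u w)(1 - sign v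
w)`. At `w = u` and at `w = v` this product equals `2` instead of `0`, whence the `-4` after
summation. -/
theorem four_mul_card_paths {u v : V} (h : T.Adj u v) :
    4 * (#{w | T.Adj u w ∧ T.Adj w v} : ℝ) =
      Fintype.card V - 4 + T.score u - T.score v - T.codeg u v := by
  have key : ∀ w, 4 * (if T.Adj u w ∧ T.Adj w v then (1 : ℝ) else 0) =
      1 + T.sign u w - T.sign v w - T.sign u w * T.sign v w - 2 * (if u = w then 1 else 0) -
        2 * if v = w then 1 else 0 := by
    intro w
    have n := T.ne_of_adj h
    rcases T.adj_trichotomy u w with rfl | hu | hu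
    · simp [T.irrefl, sign_self, T.sign_of_adj' h, n.symm]
      norm_num
    · rcases T.adj_trichotomy v w with rfl | hv | hv
      · simp [T.irrefl, sign_self, T.sign_of_adj h, n]
        norm_num
      · simp [hu, T.not_adj_of_adj hv, T.sign_of_adj hu, T.sign_of_adj hv, T.ne_of_adj hu,
          T.ne_of_adj hv]
      · simp [hu, hv, T.sign_of_adj hu, T.sign_of_adj' hv, T.ne_of_adj hu,
          (T.ne_of_adj hv).symm]
        norm_num
    · rcases T.adj_trichotomy v w with rfl | hv | hv
      · exact absurd hu (T.not_adj_of_adj h)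
      · simp [T.not_adj_of_adj hu, T.sign_of_adj' hu, T.sign_of_adj hv,
          (T.ne_of_adj hu).symm, T.ne_of_adj hv]
      · simp [T.not_adj_of_adj hu, T.sign_of_adj' hu, T.sign_of_adj' hv,
          (T.ne_of_adj hu).symm, (T.ne_of_adj hv).symm]
  rw [card_filter, Nat.cast_sum, mul_sum]
  simp only [Nat.cast_ite, Nat.cast_one, Nat.cast_zero, key, sum_sub_distrib, sum_add_distrib,
    ← mul_sum, sum_ite_eq, mem_univ, if_true, sum_const, card_univ, nsmul_eq_mul, mul_one]
  simp only [score, codeg]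
  ring

/-- The bilinear form of the sign matrix is controlled by the codegrees. -/
theorem sq_sum_sign_mul_le (a b : V → ℝ) (ha : ∀ x, |a x| ≤ 1) (hb : ∀ x, |b x| ≤ 1) :
    (∑ x, ∑ y, T.sign x y * (a x * b y)) ^ 2 ≤
      Fintype.card V * ∑ u, ∑ v, |T.codeg u v| := by
  have h1 : ∑ x, ∑ y, T.sign x y * (a x * b y) = ∑ x, a x * ∑ y, T.sign x y * b y := by
    refine sum_congr rfl fun x _ => ?_
    rw [mul_sum]
    exact sum_congr rfl fun y _ => by ring
  -- Squaring produces inner products of columns; skew-symmetry turns them into inner products of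
  -- rows.
  have h2 : ∑ x, (∑ y, T.sign x y * b y) ^ 2 = ∑ y, ∑ z, b y * b z * T.codeg y z := by
    simp only [sq, sum_mul_sum]
    simp only [codeg, mul_sum]
    rw [sum_comm]
    refine sum_congr rfl fun y _ => ?_
    rw [sum_comm]
    refine sum_congr rfl fun z _ => sum_congr rfl fun x _ => ?_
    rw [T.sign_swap x y, T.sign_swap x z]
    ring
  rw [h1]
  calc _ ≤ (#(univ : Finset V) : ℝ) * ∑ x, (a x * ∑ y, T.sign x y * b y) ^ 2 :=
        sq_sum_le_card_mul_sum_sq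
    _ ≤ Fintype.card V * ∑ x, (∑ y, T.sign x y * b y) ^ 2 := by
        rw [card_univ]
        refine mul_le_mul_of_nonneg_left (sum_le_sum fun x _ => ?_) (Nat.cast_nonneg _)
        rw [mul_pow]
        have : a x ^ 2 ≤ 1 := by
          rw [← sq_abs]
          exact pow_le_one₀ (abs_nonneg _) (ha x)
        nlinarith [sq_nonneg (∑ y, T.sign x y * b y)]
    _ ≤ _ := by
        rw [h2]
        refine mul_le_mul_of_nonneg_left (sum_le_sum fun y _ => sum_le_sum fun z _ => ?_)
          (Nat.cast_nonneg _)
        refine (le_abs_self _).trans ?_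
        rw [abs_mul, abs_mul]
        exact mul_le_of_le_one_left (abs_nonneg _) (mul_le_one₀ (hb y) (abs_nonneg _) (hb z))

end Tournament

/-! ### Transitive ratios against scores and codegrees. -/

section TransRatio

variable {n : ℕ} (T : Tournament (Fin n))

theorem transRatio_mem {u v : Fin n} (h : T.Adj u v) : |transRatio T u v - 1 / 4| ≤ 1 := by
  obtain ⟨θ, rfl, rfl⟩ := T.exists_placement h
  rw [← TFlag.density_trA]
  have h0 := TFlag.density_nonneg trA (TFlag.ofPlacement θ)
  have h1 := TFlag.density_le_one trA (TFlag.ofPlacement θ)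
  rw [abs_le]
  constructor <;> linarith

theorem transRatio_identity (hn : 3 ≤ n) {u v : Fin n} (h : T.Adj u v) :
    4 * ((n : ℝ) - 2) * (transRatio T u v - 1 / 4) = T.score u - T.score v - T.codeg u v - 2 := by
  have h1 := T.four_mul_card_paths h
  have h2 : (n : ℝ) - 2 ≠ 0 := by
    have : (3 : ℝ) ≤ n := by exact_mod_cast hn
    linarith
  rw [Fintype.card_fin] at h1
  have h3 : transRatio T u v * ((n : ℝ) - 2) = #{w | T.Adj u w ∧ T.Adj w v} := by
    rw [transRatio, div_mul_cancel₀ _ h2]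
  linear_combination 4 * h3 + h1

/-- Sum `transRatio_identity` over the arcs. The score differences give `∑ score²`, and the
codegrees remove only half of it, because an arc sees each unordered pair once while the full double
sum of codegrees is `∑ score²`. The remaining half is bounded by the deviations and a term of order
`n²`. -/
theorem sum_score_sq_le (hn : 3 ≤ n) :
    ∑ u, T.score u ^ 2 ≤ 8 * n * ∑ a ∈ T.arcs, |transRatio T a.1 a.2 - 1 / 4| + (n : ℝ) ^ 2 := by
  have h1 : ∑ a ∈ T.arcs, 4 * ((n : ℝ) - 2) * (transRatio T a.1 a.2 - 1 / 4) =
      ∑ a ∈ T.arcs, (T.score a.1 - T.score a.2) - ∑ a ∈ T.arcs, T.codeg a.1 a.2 -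
        2 * #T.arcs := by
    rw [sum_congr rfl fun a ha => transRatio_identity T hn (T.mem_arcs.1 ha)]
    simp only [sum_sub_distrib, sum_const, nsmul_eq_mul]
    ring
  have h2 := T.sum_arcs_sub T.score
  have h3 := T.two_mul_sum_arcs T.codeg T.codeg_comm
  rw [T.sum_codeg] at h3
  simp only [T.codeg_self, sum_const, card_univ, nsmul_eq_mul, Fintype.card_fin] at h3
  have h4 := T.two_mul_card_arcs
  rw [Fintype.card_fin] at h4
  rw [← mul_sum, h2] at h1
  have h5 : ∑ a ∈ T.arcs, (transRatio T a.1 a.2 - 1 / 4) ≤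
      ∑ a ∈ T.arcs, |transRatio T a.1 a.2 - 1 / 4| := sum_le_sum fun a _ => le_abs_self _
  have h6 : (0 : ℝ) ≤ ∑ a ∈ T.arcs, |transRatio T a.1 a.2 - 1 / 4| :=
    sum_nonneg fun a _ => abs_nonneg _
  have h7 : (3 : ℝ) ≤ n := by exact_mod_cast hn
  have h8 : ∑ u, T.score u * T.score u = ∑ u, T.score u ^ 2 := by simp only [sq]
  rw [h8] at h1
  have h9 : ((n : ℝ) - 2) * ∑ a ∈ T.arcs, (transRatio T a.1 a.2 - 1 / 4) ≤
      n * ∑ a ∈ T.arcs, |transRatio T a.1 a.2 - 1 / 4| :=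
    (mul_le_mul_of_nonneg_left h5 (by linarith)).trans
      (mul_le_mul_of_nonneg_right (by linarith) h6)
  nlinarith

/-- Solving the identity for the codegree leaves deviations, scores and a constant; the scores pass
from `L²` to `L¹` by Cauchy–Schwarz. Doubling the sum over arcs turns the constant `2` into `4n²`,
and the diagonal adds at most `n²`. -/
theorem sum_abs_codeg_le (hn : 3 ≤ n) :
    ∑ u, ∑ v, |T.codeg u v| ≤
      4 * n * √(n * (8 * n * ∑ a ∈ T.arcs, |transRatio T a.1 a.2 - 1 / 4| + (n : ℝ) ^ 2)) +
        8 * n * ∑ a ∈ T.arcs, |transRatio T a.1 a.2 - 1 / 4| + 5 * (n : ℝ) ^ 2 := by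
  set δ := ∑ a ∈ T.arcs, |transRatio T a.1 a.2 - 1 / 4| with hδ
  have hn' : (3 : ℝ) ≤ n := by exact_mod_cast hn
  have h1 := T.two_mul_sum_arcs (fun u v => |T.codeg u v|) (fun u v => by rw [T.codeg_comm])
  simp only [T.codeg_self, sum_const, card_univ, nsmul_eq_mul, Fintype.card_fin] at h1
  rw [abs_of_nonneg (by linarith : (0 : ℝ) ≤ n - 1)] at h1
  have h2 : ∑ u, |T.score u| ≤ √(n * (8 * n * δ + (n : ℝ) ^ 2)) := by
    refine Real.le_sqrt_of_sq_le ?_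
    refine sq_sum_le_card_mul_sum_sq.trans ?_
    simp only [sq_abs, card_univ, Fintype.card_fin]
    exact mul_le_mul_of_nonneg_left (sum_score_sq_le T hn) (Nat.cast_nonneg _)
  have h3 : ∀ a ∈ T.arcs, |T.codeg a.1 a.2| ≤
      4 * n * |transRatio T a.1 a.2 - 1 / 4| + (|T.score a.1| + |T.score a.2|) + 2 := by
    intro a ha
    have h4 := transRatio_identity T hn (T.mem_arcs.1 ha)
    have h5 : T.codeg a.1 a.2 = T.score a.1 - T.score a.2 - 2 -
        4 * ((n : ℝ) - 2) * (transRatio T a.1 a.2 - 1 / 4) := by linarith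
    have h6 : |4 * ((n : ℝ) - 2) * (transRatio T a.1 a.2 - 1 / 4)| ≤
        4 * n * |transRatio T a.1 a.2 - 1 / 4| := by
      rw [abs_mul, abs_of_nonneg (by linarith : (0 : ℝ) ≤ 4 * (n - 2))]
      exact mul_le_mul_of_nonneg_right (by linarith) (abs_nonneg _)
    rw [h5]
    rw [abs_le] at h6 ⊢
    constructor <;> linarith [neg_abs_le (T.score a.1), neg_abs_le (T.score a.2),
      le_abs_self (T.score a.1), le_abs_self (T.score a.2), h6.1, h6.2]
  have h4 : ∑ a ∈ T.arcs, (|T.score a.1| + |T.score a.2|) ≤ 2 * n * ∑ u, |T.score u| := by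
    calc _ ≤ ∑ a : Fin n × Fin n, (|T.score a.1| + |T.score a.2|) :=
          sum_le_sum_of_subset_of_nonneg (subset_univ _) fun a _ _ => by positivity
      _ = _ := by
          rw [← univ_product_univ, sum_product]
          simp only [sum_add_distrib, sum_const, card_univ, nsmul_eq_mul, Fintype.card_fin,
            ← mul_sum]
          ring
  have h5 := sum_le_sum h3
  simp only [sum_add_distrib, ← mul_sum, sum_const, nsmul_eq_mul] at h5 h4
  have h6 := T.card_arcs_le
  rw [Fintype.card_fin] at h6
  have h7 : 2 * n * ∑ u, |T.score u| ≤ 2 * n * √(n * (8 * n * δ + (n : ℝ) ^ 2)) :=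
    mul_le_mul_of_nonneg_left h2 (by positivity)
  rw [← hδ] at h5
  nlinarith

theorem sum_sq_transRatio_le (hn : 3 ≤ n) :
    16 * ((n : ℝ) - 2) ^ 2 * ∑ a ∈ T.arcs, (transRatio T a.1 a.2 - 1 / 4) ^ 2 ≤
      4 * (2 * n * ∑ u, T.score u ^ 2 + ∑ u, ∑ v, T.codeg u v ^ 2 + 4 * (n : ℝ) ^ 2) := by
  rw [mul_sum]
  have h1 : ∀ a ∈ T.arcs, 16 * ((n : ℝ) - 2) ^ 2 * (transRatio T a.1 a.2 - 1 / 4) ^ 2 ≤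
      4 * (T.score a.1 ^ 2 + T.score a.2 ^ 2 + T.codeg a.1 a.2 ^ 2 + 4) := by
    intro a ha
    have h := transRatio_identity T hn (T.mem_arcs.1 ha)
    have e : 16 * ((n : ℝ) - 2) ^ 2 * (transRatio T a.1 a.2 - 1 / 4) ^ 2 =
        (T.score a.1 - T.score a.2 - T.codeg a.1 a.2 - 2) ^ 2 := by
      rw [← h]
      ring
    rw [e]
    generalize T.score a.1 = x, T.score a.2 = y, T.codeg a.1 a.2 = z
    -- The square of a sum of four terms is at most four times the sum of their squares; the hints
    -- are the six pairwise squares that make up the difference.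
    nlinarith [sq_nonneg (x + y), sq_nonneg (x + z), sq_nonneg (x + 2), sq_nonneg (y - z),
      sq_nonneg (y - 2), sq_nonneg (z - 2)]
  refine (sum_le_sum h1).trans ((sum_le_sum_of_subset_of_nonneg (subset_univ _)
    fun a _ _ => by positivity).trans (le_of_eq ?_))
  rw [← univ_product_univ, sum_product]
  simp only [sum_add_distrib, sum_const, card_univ, nsmul_eq_mul, Fintype.card_fin, ← mul_sum]
  ring

end TransRatio

/-! ### Counting labelled copies. -/

/-- Resampling one coordinate preserves the uniform measure: swapping `g i` with the new value `x`
is an involution of the pairs `(g, x)`. -/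
theorem sum_sum_update {ι V : Type*} [Fintype ι] [DecidableEq ι] [Fintype V] (i : ι) (Φ : (ι → V) → ℝ) :
    ∑ g, ∑ x, Φ (Function.update g i x) = Fintype.card V * ∑ g, Φ g := by
  have hinv : Function.Involutive
      (fun p : (ι → V) × V => (Function.update p.1 i p.2, p.1 i)) := by
    rintro ⟨g, x⟩
    simp
  have h := Equiv.sum_comp hinv.toPerm fun p : (ι → V) × V => Φ p.1
  simp only [Function.Involutive.coe_toPerm, Fintype.sum_prod_type] at h
  rw [h, mul_sum]
  simp

theorem abs_sum_sub_sum_embedding_le {ι V : Type*} [Fintype ι] [DecidableEq ι] [Fintype V] (Φ : (ι → V) → ℝ)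
    (hΦ : ∀ g, |Φ g| ≤ 1) :
    |∑ g, Φ g - ∑ f : ι ↪ V, Φ f| ≤
      (Fintype.card V : ℝ) ^ Fintype.card ι - Fintype.card (ι ↪ V) := by
  have h1 : ∀ Ψ : (ι → V) → ℝ, ∑ f : ι ↪ V, Ψ f = ∑ g with Function.Injective g, Ψ g := by
    intro Ψ
    rw [← (Equiv.subtypeInjectiveEquivEmbedding ι V).sum_comp, ← sum_subtype_eq_sum_filter]
    rw [subtype_univ]
    rfl
  have h2 : (Fintype.card (ι ↪ V) : ℝ) = #{g : ι → V | Function.Injective g} := by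
    have := h1 fun _ => 1
    simpa using this
  have h3 : (Fintype.card V : ℝ) ^ Fintype.card ι = #(univ : Finset (ι → V)) := by
    rw [card_univ, Fintype.card_fun]
    push_cast
    rfl
  rw [h1, h2, h3, ← sum_filter_add_sum_filter_not univ (fun g : ι → V => Function.Injective g) Φ,
    add_sub_cancel_left, ← card_filter_add_card_filter_not (s := (univ : Finset (ι → V)))
      (fun g : ι → V => Function.Injective g)]
  push_cast
  rw [add_sub_cancel_left]
  refine (abs_sum_le_sum_abs _ _).trans ((sum_le_sum fun g _ => hΦ g).trans ?_)
  simp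

namespace Tournament

variable {V : Type*} (T : Tournament V) {m : ℕ} (R : Tournament (Fin m))

/-- The factor of the pair `p` in the indicator function of the copies of `R` in `T`. -/
noncomputable def pairWeight (p : Fin m × Fin m) (g : Fin m → V) : ℝ :=
  (1 + R.sign p.1 p.2 * T.sign (g p.1) (g p.2)) / 2

theorem abs_sign_mul_sign_le (p : Fin m × Fin m) (g : Fin m → V) :
    |R.sign p.1 p.2 * T.sign (g p.1) (g p.2)| ≤ 1 := by
  rw [abs_mul]
  exact mul_le_one₀ (R.abs_sign_le _ _) (abs_nonneg _) (T.abs_sign_le _ _)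

theorem pairWeight_nonneg (p : Fin m × Fin m) (g : Fin m → V) : 0 ≤ T.pairWeight R p g := by
  have := abs_le.1 (T.abs_sign_mul_sign_le R p g)
  unfold pairWeight
  linarith [this.1]

theorem pairWeight_le_one (p : Fin m × Fin m) (g : Fin m → V) : T.pairWeight R p g ≤ 1 := by
  have := abs_le.1 (T.abs_sign_mul_sign_le R p g)
  unfold pairWeight
  linarith [this.2]

theorem abs_prod_pairWeight_le (E : Finset (Fin m × Fin m)) (g : Fin m → V) :
    |∏ p ∈ E, T.pairWeight R p g| ≤ 1 := by
  rw [abs_of_nonneg (prod_nonneg fun p _ => T.pairWeight_nonneg R p g)]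
  exact prod_le_one (fun p _ => T.pairWeight_nonneg R p g) fun p _ => T.pairWeight_le_one R p g

theorem pairWeight_embedding {p : Fin m × Fin m} (hp : p.1 ≠ p.2) (f : Fin m ↪ V) :
    T.pairWeight R p f = if T.Adj (f p.1) (f p.2) ↔ R.Adj p.1 p.2 then 1 else 0 := by
  have hne : f p.1 ≠ f p.2 := fun h => hp (f.injective h)
  unfold pairWeight
  rcases R.adj_trichotomy p.1 p.2 with h | h | h
  · exact absurd h hp
  · rcases T.adj_trichotomy (f p.1) (f p.2) with h' | h' | h'
    · exact absurd h' hne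
    · simp [h, h', sign_of_adj]
    · simp [h, T.not_adj_of_adj h', sign_of_adj, T.sign_of_adj' h']
  · rcases T.adj_trichotomy (f p.1) (f p.2) with h' | h' | h'
    · exact absurd h' hne
    · simp [R.not_adj_of_adj h, h', sign_of_adj, R.sign_of_adj' h]
    · simp [R.not_adj_of_adj h, T.not_adj_of_adj h', R.sign_of_adj' h, T.sign_of_adj' h']

/-- The increasing pairs of indices. -/
def increasingPairs (m : ℕ) : Finset (Fin m × Fin m) := {p | p.1 < p.2}

/-- One orientation of each pair suffices, since the arc on a pair determines its reverse. -/
theorem prod_pairWeight_embedding (f : Fin m ↪ V) :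
    ∏ p ∈ increasingPairs m, T.pairWeight R p f =
      if ∀ i j, T.Adj (f i) (f j) ↔ R.Adj i j then 1 else 0 := by
  have h0 : ∀ p ∈ increasingPairs m, p.1 < p.2 := fun p hp => by
    simpa [increasingPairs] using hp
  rw [prod_congr rfl fun p hp => T.pairWeight_embedding R (h0 p hp).ne f, prod_ite_zero,
    prod_const_one]
  congr 1
  rw [eq_iff_iff]
  constructor
  · intro h i j
    rcases lt_trichotomy i j with hij | rfl | hij
    · exact h (i, j) (by simpa [increasingPairs] using hij)
    · exact iff_of_false (T.irrefl _) (R.irrefl _)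
    · have h1 := h (j, i) (by simpa [increasingPairs] using hij)
      have h2 := T.adj_iff (f i) (f j) (fun h => hij.ne' (f.injective h))
      have h3 := R.adj_iff i j hij.ne'
      rw [h2, h3]
      exact not_congr h1
  · intro h p _
    exact h _ _

variable [Fintype V]

/-- With all coordinates but `i` and `j` frozen, no factor depends on both `x = g i` and `y = g j`.
The product splits as `a(x) b(y)` with factors bounded by `1`, and `sq_sum_sign_mul_le` applies. -/
theorem abs_sum_sign_mul_prod_le {E : Finset (Fin m × Fin m)} (hE : ∀ p ∈ E, p.1 < p.2)
    {i j : Fin m} (hij : i < j) (hp : (i, j) ∉ E) :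
    (Fintype.card V : ℝ) ^ 2 *
        |∑ g : Fin m → V, T.sign (g i) (g j) * ∏ p ∈ E, T.pairWeight R p g| ≤
      (Fintype.card V : ℝ) ^ m * √(Fintype.card V * ∑ u, ∑ v, |T.codeg u v|) := by
  set Φ : (Fin m → V) → ℝ := fun g => T.sign (g i) (g j) * ∏ p ∈ E, T.pairWeight R p g with hΦ
  -- Resampling the two coordinates costs the factor `n ^ 2`.
  have h1 : (Fintype.card V : ℝ) ^ 2 * ∑ g, Φ g =
      ∑ g, ∑ x, ∑ y, Φ (Function.update (Function.update g i x) j y) := by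
    rw [sum_sum_update i fun g => ∑ y, Φ (Function.update g j y), sum_sum_update]
    ring
  have h2 : ∀ g, |∑ x, ∑ y, Φ (Function.update (Function.update g i x) j y)| ≤
      √(Fintype.card V * ∑ u, ∑ v, |T.codeg u v|) := by
    intro g
    refine Real.le_sqrt_of_sq_le ?_
    rw [sq_abs]
    have h3 : ∀ x y, Φ (Function.update (Function.update g i x) j y) = T.sign x y *
        ((∏ p ∈ E with ¬(p.1 = j ∨ p.2 = j), T.pairWeight R p (Function.update g i x)) *
          ∏ p ∈ E with p.1 = j ∨ p.2 = j, T.pairWeight R p (Function.update g j y)) := by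
      intro x y
      simp only [hΦ, Function.update_self, Function.update_of_ne hij.ne]
      congr 1
      rw [← prod_filter_mul_prod_filter_not E fun p => p.1 = j ∨ p.2 = j, mul_comm]
      congr 1
      · refine prod_congr rfl fun p hp' => ?_
        have := (mem_filter.1 hp').2
        push Not at this
        simp [pairWeight, Function.update_of_ne this.1, Function.update_of_ne this.2]
      · refine prod_congr rfl fun p hp' => ?_
        obtain ⟨hpE, hpj⟩ := mem_filter.1 hp'
        have hlt := hE p hpE
        -- A pair touching `j` cannot touch `i`: `(i, j)` is excluded from `E`, and `(j, i)` is not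
        -- increasing.
        have n1 : p.1 ≠ i := by
          intro h
          have h2 : p.2 = j := hpj.resolve_left (by rw [h]; exact hij.ne)
          exact hp (by rw [← h, ← h2]; exact hpE)
        have n2 : p.2 ≠ i := by
          intro h
          rcases hpj with h' | h'
          · rw [h, h'] at hlt
            exact lt_asymm hlt hij
          · exact hij.ne (h.symm.trans h')
        rw [Function.update_comm hij.ne]
        simp [pairWeight, Function.update_of_ne n1, Function.update_of_ne n2]
    simp only [h3]
    exact T.sq_sum_sign_mul_le _ _ (fun x => T.abs_prod_pairWeight_le R _ _)
      fun y => T.abs_prod_pairWeight_le R _ _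
  rw [← abs_of_nonneg (by positivity : (0 : ℝ) ≤ (Fintype.card V : ℝ) ^ 2), ← abs_mul, h1]
  refine (abs_sum_le_sum_abs _ _).trans ((sum_le_sum fun g _ => h2 g).trans ?_)
  simp

/-- Pairs are added one at a time. Half of the new weight is the constant `1/2`, which halves the
main term; the sign half is an error bounded by `abs_sum_sign_mul_prod_le`. -/
theorem abs_sum_prod_pairWeight_sub_le {E : Finset (Fin m × Fin m)} (hE : ∀ p ∈ E, p.1 < p.2) :
    (Fintype.card V : ℝ) ^ 2 * |∑ g : Fin m → V, ∏ p ∈ E, T.pairWeight R p g -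
        (Fintype.card V : ℝ) ^ m / 2 ^ #E| ≤
      #E * ((Fintype.card V : ℝ) ^ m * √(Fintype.card V * ∑ u, ∑ v, |T.codeg u v|)) := by
  induction E using Finset.induction_on with
  | empty => simp
  | insert p E hp ih =>
    have ih' := ih fun q hq => hE q (mem_insert_of_mem hq)
    have h1 := T.abs_sum_sign_mul_prod_le R (fun q hq => hE q (mem_insert_of_mem hq))
      (hE p (mem_insert_self _ _)) (by simpa using hp)
    rw [card_insert_of_notMem hp]
    have e : ∑ g : Fin m → V, ∏ q ∈ insert p E, T.pairWeight R q g -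
        (Fintype.card V : ℝ) ^ m / 2 ^ (#E + 1) =
        1 / 2 * (∑ g : Fin m → V, ∏ q ∈ E, T.pairWeight R q g -
          (Fintype.card V : ℝ) ^ m / 2 ^ #E) + R.sign p.1 p.2 / 2 *
          ∑ g : Fin m → V, T.sign (g p.1) (g p.2) * ∏ q ∈ E, T.pairWeight R q g := by
      rw [mul_sub, mul_sum, mul_sum]
      have : ∀ g : Fin m → V, ∏ q ∈ insert p E, T.pairWeight R q g =
          1 / 2 * ∏ q ∈ E, T.pairWeight R q g + R.sign p.1 p.2 / 2 *
            (T.sign (g p.1) (g p.2) * ∏ q ∈ E, T.pairWeight R q g) := by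
        intro g
        rw [prod_insert hp]
        nth_rewrite 1 [pairWeight]
        ring
      simp only [this, sum_add_distrib]
      rw [pow_succ]
      ring
    rw [e]
    set A := ∑ g : Fin m → V, ∏ q ∈ E, T.pairWeight R q g - (Fintype.card V : ℝ) ^ m / 2 ^ #E
    set B := ∑ g : Fin m → V, T.sign (g p.1) (g p.2) * ∏ q ∈ E, T.pairWeight R q g
    set K := (Fintype.card V : ℝ) ^ m * √(Fintype.card V * ∑ u, ∑ v, |T.codeg u v|)
    have h2 : |1 / 2 * A + R.sign p.1 p.2 / 2 * B| ≤ |A| + |B| := by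
      refine (abs_add_le _ _).trans (add_le_add ?_ ?_)
      · rw [abs_mul]
        exact mul_le_of_le_one_left (abs_nonneg _) (by norm_num [abs_of_pos])
      · rw [abs_mul, abs_div]
        refine mul_le_of_le_one_left (abs_nonneg _) ?_
        have := R.abs_sign_le p.1 p.2
        rw [abs_of_pos (by norm_num : (0 : ℝ) < 2)]
        linarith
    push_cast
    have h3 := mul_le_mul_of_nonneg_left h2
      (by positivity : (0 : ℝ) ≤ (Fintype.card V : ℝ) ^ 2)
    linarith

/-- The number of labelled copies of `R` in `T` is controlled by the codegrees. -/
theorem abs_card_placement_sub_le :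
    (Fintype.card V : ℝ) ^ 2 * |(Fintype.card (T.Placement R) : ℝ) -
        (Fintype.card V : ℝ) ^ m / 2 ^ #(increasingPairs m)| ≤
      (Fintype.card V : ℝ) ^ 2 * ((Fintype.card V : ℝ) ^ m - Fintype.card (Fin m ↪ V)) +
      #(increasingPairs m) *
        ((Fintype.card V : ℝ) ^ m * √(Fintype.card V * ∑ u, ∑ v, |T.codeg u v|)) := by
  have h1 := T.abs_sum_prod_pairWeight_sub_le R (E := increasingPairs m) fun p hp => by
    simpa [increasingPairs] using hp
  have h2 := abs_sum_sub_sum_embedding_le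
    (fun g : Fin m → V => ∏ p ∈ increasingPairs m, T.pairWeight R p g)
    fun g => T.abs_prod_pairWeight_le R _ g
  have h0 : ∑ f : Fin m ↪ V, ∏ p ∈ increasingPairs m, T.pairWeight R p f =
      Fintype.card (T.Placement R) := by
    simp only [prod_pairWeight_embedding, sum_boole, Fintype.card_subtype]
  rw [h0, Fintype.card_fin] at h2
  generalize ∑ g : Fin m → V, ∏ p ∈ increasingPairs m, T.pairWeight R p g = S at h1 h2
  have h3 : |(Fintype.card (T.Placement R) : ℝ) -
        (Fintype.card V : ℝ) ^ m / 2 ^ #(increasingPairs m)| ≤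
      |S - Fintype.card (T.Placement R)| +
        |S - (Fintype.card V : ℝ) ^ m / 2 ^ #(increasingPairs m)| := by
    rw [abs_sub_comm S]
    refine le_trans (le_of_eq ?_) (abs_add_le _ _)
    congr 1
    ring
  have h4 := mul_le_mul_of_nonneg_left (h3.trans (add_le_add_left h2 _))
    (by positivity : (0 : ℝ) ≤ (Fintype.card V : ℝ) ^ 2)
  linarith

/-- Averages over labelled copies. -/
theorem sum_embedding_eq (W : Tournament (Fin m) → ℝ) :
    ∑ f : Fin m ↪ V, W (T.comap f) =
      ∑ R : Tournament (Fin m), Fintype.card (T.Placement R) * W R := by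
  rw [← sum_fiberwise_of_maps_to (s := univ) (t := univ) (g := fun f : Fin m ↪ V => T.comap f)
    fun _ _ => mem_univ _]
  refine sum_congr rfl fun R _ => ?_
  rw [sum_congr rfl (g := fun _ => W R) fun f hf => by rw [(mem_filter.1 hf).2], sum_const,
    nsmul_eq_mul, Fintype.card_subtype]
  congr 3
  ext f
  simp only [mem_filter, mem_univ, true_and]
  constructor
  · rintro rfl i j
    rfl
  · intro h
    ext i j
    exact h i j

/-! ### Arc reversal and sign monomials. -/

/-- Reversal of the arc between `a` and `b`. -/
def flip {V : Type*} (T : Tournament V) (a b : V) : Tournament V where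
  Adj u v := if (u = a ∧ v = b) ∨ (u = b ∧ v = a) then T.Adj v u else T.Adj u v
  irrefl u := by simp [T.irrefl]
  adj_iff u v h := by
    have e : ((v = a ∧ u = b) ∨ (v = b ∧ u = a)) ↔ ((u = a ∧ v = b) ∨ (u = b ∧ v = a)) := by tauto
    simp only [e]
    split_ifs
    · exact T.adj_iff v u h.symm
    · exact T.adj_iff u v h

theorem flip_adj {V : Type*} (T : Tournament V) (a b u v : V) : (T.flip a b).Adj u v ↔
    if (u = a ∧ v = b) ∨ (u = b ∧ v = a) then T.Adj v u else T.Adj u v := Iff.rfl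

theorem flip_involutive {V : Type*} (a b : V) :
    Function.Involutive fun T : Tournament V => T.flip a b := by
  intro T
  ext u v
  have e : ((v = a ∧ u = b) ∨ (v = b ∧ u = a)) ↔ ((u = a ∧ v = b) ∨ (u = b ∧ v = a)) := by tauto
  simp only [flip_adj, e]
  split_ifs <;> rfl

theorem sign_flip_self {V : Type*} (T : Tournament V) (a b : V) :
    (T.flip a b).sign a b = -T.sign a b := by
  rw [← T.sign_swap a b]
  simp [sign, flip_adj]

theorem sign_flip_of_ne {V : Type*} (T : Tournament V) {a b u v : V}
    (h : ¬ ((u = a ∧ v = b) ∨ (u = b ∧ v = a))) : (T.flip a b).sign u v = T.sign u v := by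
  have e : ¬ ((v = a ∧ u = b) ∨ (v = b ∧ u = a)) := by tauto
  simp only [sign, flip_adj, if_neg h, if_neg e]

theorem sum_eq_zero_of_flip {m : ℕ} (a b : Fin m) (W : Tournament (Fin m) → ℝ)
    (hW : ∀ R, W (R.flip a b) = -W R) : ∑ R, W R = 0 := by
  have := Equiv.sum_comp (flip_involutive a b).toPerm W
  simp only [Function.Involutive.coe_toPerm, hW, sum_neg_distrib] at this
  linarith

end Tournament

theorem sum_fin_succ_arrow {m : ℕ} {V : Type*} [Fintype V] (Φ : (Fin (m + 1) → V) → ℝ) :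
    ∑ g, Φ g = ∑ x, ∑ g : Fin m → V, Φ (Fin.cons x g) := by
  rw [← (Fin.consEquiv fun _ => V).sum_comp, Fintype.sum_prod_type]
  rfl

namespace Tournament

variable {V : Type*} [Fintype V] (T : Tournament V)

theorem sum_score_sq_eq : ∑ u, T.score u ^ 2 =
    ∑ g : Fin 3 → V, T.sign (g 0) (g 1) * T.sign (g 0) (g 2) := by
  simp only [sum_fin_succ_arrow, score, sq, sum_mul_sum]
  simp only [univ_unique, sum_singleton]
  rfl

/-- The monomial runs over the edges of the four-cycle `0, 2, 1, 3`, in a form suited to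
`IsQuasiRandom.tendsto_average`. -/
theorem sum_codeg_sq_eq : ∑ u, ∑ v, T.codeg u v ^ 2 = ∑ g : Fin 4 → V,
    T.sign (g 0) (g 2) * T.sign (g 1) (g 2) * (T.sign (g 0) (g 3) * T.sign (g 1) (g 3)) := by
  simp only [sum_fin_succ_arrow, codeg, sq, sum_mul_sum]
  simp only [univ_unique, sum_singleton]
  rfl

end Tournament

/-! ### Labelled against unlabelled densities. -/

namespace Tournament

theorem card_placement_div {V : Type*} [Fintype V] (T : Tournament V) {m : ℕ}
    (H : Tournament (Fin m)) (hV : m ≤ Fintype.card V) :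
    (Fintype.card (T.Placement H) : ℝ) / Fintype.card (Fin m ↪ V) =
      (TFlag.unit H).labelProb *
        (TFlag.ofTournament H).density (TFlag.ofTournament T) := by
  refine Eq.trans ?_ (TFlag.sum_density_placement T (TFlag.unit H) hV)
  simp [TFlag.density_unit]

/-- In a random tournament all labelled tournaments on a given vertex set are equally likely. The
factor `labelProb`, the number of automorphisms over `m!`, converts to unlabelled density. -/
theorem labelProb_mul_phiRdm {m : ℕ} (H : Tournament (Fin m)) :
    (TFlag.unit H).labelProb * phiRdm.eval (TFlag.ofTournament H) =
      1 / Fintype.card (Tournament (Fin m)) := by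
  have h1 : phiRdm.eval (TFlag.ofTournament H) = (∑ R : Tournament (Fin m),
      (TFlag.ofTournament H).density (TFlag.ofTournament R)) /
        Fintype.card (Tournament (Fin m)) := by
    rw [phiRdm.eval_eq_sum _ le_rfl]
    exact sum_mul_rdmDensity _ fun F G h => TFlag.density_congr _ h
  rw [h1, mul_div_assoc', mul_sum]
  congr 1
  have h2 : ∀ R : Tournament (Fin m), (TFlag.unit H).labelProb *
      (TFlag.ofTournament H).density (TFlag.ofTournament R) =
        (Fintype.card (R.Placement H) : ℝ) / Fintype.card (Fin m ↪ Fin m) :=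
    fun R => (card_placement_div R H (by simp)).symm
  have h3 : ∀ θ : Fin m ↪ Fin m, #{R : Tournament (Fin m) |
      ∀ i j, R.Adj (θ i) (θ j) ↔ H.Adj i j} = 1 := by
    intro θ
    have := Tournament.card_comap θ (fun A => A = H) (fun _ => True) (by simp)
    have hH : #{A : Tournament (Fin m) | A = H} = 1 := card_eq_one.2 ⟨H, by ext; simp⟩
    simp only [and_true, filter_true, card_univ, hH, one_mul] at this
    refine Nat.eq_of_mul_eq_mul_left Fintype.card_pos
      ((congrArg (_ * #·) (filter_congr fun R _ => ?_)).trans (this.trans (mul_one _).symm))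
    constructor
    · intro h
      ext i j
      exact h i j
    · rintro rfl i j
      rfl
  have h4 : ∑ R : Tournament (Fin m), Fintype.card (R.Placement H) =
      Fintype.card (Fin m ↪ Fin m) := by
    simp only [Fintype.card_subtype, card_filter]
    rw [sum_comm]
    simp only [← card_filter, h3]
    simp
  simp only [h2]
  rw [← sum_div, ← Nat.cast_sum, h4, div_self]
  have : Nonempty (Fin m ↪ Fin m) := ⟨Function.Embedding.refl _⟩
  exact_mod_cast Fintype.card_ne_zero

theorem sum_placement_arcType {V : Type*} [Fintype V] (T : Tournament V) (f : V → V → ℝ) :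
    ∑ θ : T.Placement arcType, f (θ.1 0) (θ.1 1) = ∑ a ∈ T.arcs, f a.1 a.2 := by
  refine sum_bij (fun θ _ => (θ.1 0, θ.1 1)) (fun θ _ => T.mem_arcs.2 θ.adj) ?_ ?_
    fun _ _ => rfl
  · intro θ _ θ' _ h
    obtain ⟨h0, h1⟩ := Prod.mk.inj h
    refine Subtype.ext (DFunLike.ext _ _ fun i => ?_)
    fin_cases i
    · exact h0
    · exact h1
  · rintro ⟨u, v⟩ ha
    obtain ⟨θ, h0, h1⟩ := T.exists_placement (T.mem_arcs.1 ha)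
    exact ⟨θ, mem_univ _, Prod.ext h0 h1⟩

theorem card_placement_arcType {V : Type*} [Fintype V] (T : Tournament V) :
    (Fintype.card (T.Placement arcType) : ℝ) = #T.arcs := by
  simpa using T.sum_placement_arcType fun _ _ => 1

end Tournament

/-! ### Quasi-random sequences. -/

section Sequences

variable {N : ℕ → ℕ} (T : ∀ i, Tournament (Fin (N i)))

theorem tendsto_card_embedding_div (hN : Tendsto N atTop atTop) (m : ℕ) :
    Tendsto (fun i => (Fintype.card (Fin m ↪ Fin (N i)) : ℝ) / (N i : ℝ) ^ m) atTop (𝓝 1) := by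
  have h : Tendsto (fun n : ℕ => (n.descFactorial m : ℝ) / (n : ℝ) ^ m) atTop (𝓝 1) := by
    refine (isEquivalent_iff_tendsto_one ?_).1 (isEquivalent_descFactorial m)
    filter_upwards [eventually_gt_atTop 0] with n hn
    positivity
  refine (h.comp hN).congr fun i => ?_
  simp [Function.comp, Fintype.card_embedding_eq]

/-- Multiplying by the nonzero `labelProb` passes to labelled copies, where the target no longer
depends on `H`. -/
theorem isQuasiRandom_iff_tendsto_placement (hN : Tendsto N atTop atTop) :
    IsQuasiRandom T ↔ ∀ (m : ℕ) (H : Tournament (Fin m)), Tendsto (fun i =>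
      (Fintype.card ((T i).Placement H) : ℝ) / Fintype.card (Fin m ↪ Fin (N i))) atTop
        (𝓝 (1 / Fintype.card (Tournament (Fin m)))) := by
  refine forall₂_congr fun m H => ?_
  have hp := Tournament.labelProb_mul_phiRdm H
  have h0 : (TFlag.unit H).labelProb ≠ 0 := by
    intro h
    rw [h, zero_mul] at hp
    have : (0 : ℝ) < 1 / Fintype.card (Tournament (Fin m)) := by
      have : (0 : ℝ) < Fintype.card (Tournament (Fin m)) := by exact_mod_cast Fintype.card_pos
      positivity
    exact this.ne hp
  have he : (fun i => (TFlag.unit H).labelProb *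
      (TFlag.ofTournament H).density (TFlag.ofTournament (T i))) =ᶠ[atTop] fun i =>
        (Fintype.card ((T i).Placement H) : ℝ) / Fintype.card (Fin m ↪ Fin (N i)) := by
    filter_upwards [hN.eventually_ge_atTop m] with i hi
    rw [Tournament.card_placement_div _ _ (by simpa using hi)]
  rw [← tendsto_congr' he, ← hp]
  refine ⟨fun h => h.const_mul _, fun h => ?_⟩
  simpa [h0] using h.const_mul (TFlag.unit H).labelProb⁻¹

variable {T}

/-- In a quasi-random sequence, every function of labelled sub-tournaments has the same limiting
average as over all tournaments. -/
theorem IsQuasiRandom.tendsto_average (hT : IsQuasiRandom T) (hN : Tendsto N atTop atTop) {m : ℕ}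
    (Φ : ∀ i, (Fin m → Fin (N i)) → ℝ) (hΦ : ∀ i g, |Φ i g| ≤ 1) (W : Tournament (Fin m) → ℝ)
    (hW : ∀ i (f : Fin m ↪ Fin (N i)), Φ i f = W ((T i).comap f)) (hW0 : ∑ R, W R = 0) :
    Tendsto (fun i => (∑ g, Φ i g) / (N i : ℝ) ^ m) atTop (𝓝 0) := by
  have h1 := (isQuasiRandom_iff_tendsto_placement T hN).1 hT m
  have hE := tendsto_card_embedding_div hN m
  have h2 : Tendsto (fun i => (∑ f : Fin m ↪ Fin (N i), Φ i f) / Fintype.card (Fin m ↪ Fin (N i)))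
      atTop (𝓝 0) := by
    have h3 := tendsto_finsetSum univ fun R (_ : R ∈ univ) => (h1 R).mul_const (W R)
    rw [← mul_sum, hW0, mul_zero] at h3
    refine h3.congr fun i => ?_
    simp only [hW, Tournament.sum_embedding_eq, sum_div]
    exact sum_congr rfl fun R _ => by ring
  have h4 : Tendsto (fun i => (∑ f : Fin m ↪ Fin (N i), Φ i f) / (N i : ℝ) ^ m) atTop (𝓝 0) := by
    have := h2.mul hE
    rw [zero_mul] at this
    refine this.congr' ?_
    filter_upwards [hN.eventually_ge_atTop m] with i hi
    have : (Fintype.card (Fin m ↪ Fin (N i)) : ℝ) ≠ 0 := by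
      have : Nonempty (Fin m ↪ Fin (N i)) := ⟨Fin.castLEEmb hi⟩
      exact_mod_cast Fintype.card_ne_zero
    field_simp
  -- Non-injective maps form a vanishing proportion of all maps.
  have h5 : Tendsto (fun i => (∑ g, Φ i g) / (N i : ℝ) ^ m -
      (∑ f : Fin m ↪ Fin (N i), Φ i f) / (N i : ℝ) ^ m) atTop (𝓝 0) := by
    have h6 : Tendsto (fun i => 1 - (Fintype.card (Fin m ↪ Fin (N i)) : ℝ) / (N i : ℝ) ^ m) atTop
        (𝓝 0) := by simpa using hE.const_sub 1
    refine squeeze_zero_norm' ?_ h6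
    filter_upwards [hN.eventually_gt_atTop 0] with i hi
    have hpos : (0 : ℝ) < (N i : ℝ) ^ m := by positivity
    rw [Real.norm_eq_abs, ← sub_div, abs_div, abs_of_pos hpos, div_le_iff₀ hpos, sub_mul,
      div_mul_cancel₀ _ hpos.ne', one_mul]
    simpa using abs_sum_sub_sum_embedding_le (Φ i) (hΦ i)
  simpa using h5.add h4

theorem IsQuasiRandom.tendsto_score (hT : IsQuasiRandom T) (hN : Tendsto N atTop atTop) :
    Tendsto (fun i => (∑ u, (T i).score u ^ 2) / (N i : ℝ) ^ 3) atTop (𝓝 0) := by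
  simp only [Tournament.sum_score_sq_eq]
  refine hT.tendsto_average hN (fun i g => (T i).sign (g 0) (g 1) * (T i).sign (g 0) (g 2))
    (fun i g => ?_) (fun R => R.sign 0 1 * R.sign 0 2) (fun i f => rfl) ?_
  · rw [abs_mul]
    exact mul_le_one₀ ((T i).abs_sign_le _ _) (abs_nonneg _) ((T i).abs_sign_le _ _)
  · refine Tournament.sum_eq_zero_of_flip 0 1 _ fun R => ?_
    rw [R.sign_flip_self, R.sign_flip_of_ne (by decide)]
    ring

/-- The pair `0, 2` occurs exactly once in the monomial, so reversing its arc negates the weight and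
the sum over all tournaments is zero. -/
theorem IsQuasiRandom.tendsto_codeg (hT : IsQuasiRandom T) (hN : Tendsto N atTop atTop) :
    Tendsto (fun i => (∑ u, ∑ v, (T i).codeg u v ^ 2) / (N i : ℝ) ^ 4) atTop (𝓝 0) := by
  simp only [Tournament.sum_codeg_sq_eq]
  refine hT.tendsto_average hN (fun i g => (T i).sign (g 0) (g 2) * (T i).sign (g 1) (g 2) *
      ((T i).sign (g 0) (g 3) * (T i).sign (g 1) (g 3)))
    (fun i g => ?_) (fun R => R.sign 0 2 * R.sign 1 2 * (R.sign 0 3 * R.sign 1 3))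
    (fun i f => rfl) ?_
  · have h : ∀ a b c d : Fin (N i), |(T i).sign a b * (T i).sign c d| ≤ 1 := fun a b c d => by
      rw [abs_mul]
      exact mul_le_one₀ ((T i).abs_sign_le _ _) (abs_nonneg _) ((T i).abs_sign_le _ _)
    rw [abs_mul]
    exact mul_le_one₀ (h _ _ _ _) (abs_nonneg _) (h _ _ _ _)
  · refine Tournament.sum_eq_zero_of_flip 0 2 _ fun R => ?_
    rw [R.sign_flip_self, R.sign_flip_of_ne (by decide), R.sign_flip_of_ne (by decide),
      R.sign_flip_of_ne (by decide)]
    ring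

/-- The mean square deviation of the transitive ratio from `1/4`. -/
theorem IsQuasiRandom.tendsto_sum_sq (hT : IsQuasiRandom T) (hN : Tendsto N atTop atTop) :
    Tendsto (fun i => (∑ a ∈ (T i).arcs, (transRatio (T i) a.1 a.2 - 1 / 4) ^ 2) / (N i : ℝ) ^ 2)
      atTop (𝓝 0) := by
  have hN' : Tendsto (fun i => (N i : ℝ)) atTop atTop := tendsto_natCast_atTop_atTop.comp hN
  have h1 : Tendsto (fun i => 2 * ((∑ u, (T i).score u ^ 2) / (N i : ℝ) ^ 3) +
      (∑ u, ∑ v, (T i).codeg u v ^ 2) / (N i : ℝ) ^ 4 + 4 * ((N i : ℝ) ^ 2)⁻¹) atTop (𝓝 0) := by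
    have h2 := ((tendsto_pow_atTop two_ne_zero).comp hN').inv_tendsto_atTop
    simpa using (((hT.tendsto_score hN).const_mul 2).add (hT.tendsto_codeg hN)).add
      (h2.const_mul 4)
  refine squeeze_zero' (Eventually.of_forall fun i => by positivity) ?_ h1
  filter_upwards [hN.eventually_ge_atTop 4] with i hi
  have h3 := sum_sq_transRatio_le (T i) (by omega)
  have hn : (4 : ℝ) ≤ N i := by exact_mod_cast hi
  have hX : 0 ≤ ∑ a ∈ (T i).arcs, (transRatio (T i) a.1 a.2 - 1 / 4) ^ 2 := by positivity
  generalize ∑ a ∈ (T i).arcs, (transRatio (T i) a.1 a.2 - 1 / 4) ^ 2 = X at *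
  generalize ∑ u, (T i).score u ^ 2 = S at *
  generalize ∑ u, ∑ v, (T i).codeg u v ^ 2 = Q at *
  generalize (N i : ℝ) = n at *
  have hn0 : 0 < n := by linarith
  -- The threshold `n ≥ 4` is exactly what gives `n ≤ 2(n - 2)`.
  have h4 : n ^ 2 ≤ 4 * (n - 2) ^ 2 := by nlinarith
  have h5 : n ^ 2 * X ≤ 2 * n * S + Q + 4 * n ^ 2 := by nlinarith
  have e : 2 * (S / n ^ 3) + Q / n ^ 4 + 4 * (n ^ 2)⁻¹ =
      (2 * n * S + Q + 4 * n ^ 2) / n ^ 4 := by field_simp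
  rw [e, div_le_div_iff₀ (by positivity) (by positivity)]
  nlinarith [mul_le_mul_of_nonneg_right h5 (sq_nonneg n)]

/-- Deviations are at most `1`, so squares are dominated by absolute values; Cauchy–Schwarz over at
most `n²` arcs gives the converse. -/
theorem tendsto_sum_abs_iff_sum_sq (hN : Tendsto N atTop atTop) :
    Tendsto (fun i => (∑ a ∈ (T i).arcs, |transRatio (T i) a.1 a.2 - 1 / 4|) / (N i : ℝ) ^ 2)
      atTop (𝓝 0) ↔
    Tendsto (fun i => (∑ a ∈ (T i).arcs, (transRatio (T i) a.1 a.2 - 1 / 4) ^ 2) / (N i : ℝ) ^ 2)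
      atTop (𝓝 0) := by
  constructor
  · refine fun h => squeeze_zero (fun i => by positivity) (fun i => ?_) h
    refine div_le_div_of_nonneg_right (sum_le_sum fun a ha => ?_) (by positivity)
    have := transRatio_mem (T i) ((T i).mem_arcs.1 ha)
    rw [← sq_abs, sq]
    exact mul_le_of_le_one_left (abs_nonneg _) this
  · intro h
    have h1 := (Real.continuous_sqrt.tendsto 0).comp h
    rw [Real.sqrt_zero] at h1
    refine squeeze_zero' (Eventually.of_forall fun i => by positivity) ?_ h1
    filter_upwards [hN.eventually_gt_atTop 0] with i hi
    have hn : (0 : ℝ) < N i := by exact_mod_cast hi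
    refine Real.le_sqrt_of_sq_le ?_
    have h2 := sq_sum_le_card_mul_sum_sq (s := (T i).arcs)
      (f := fun a => |transRatio (T i) a.1 a.2 - 1 / 4|)
    simp only [sq_abs] at h2
    have h3 := (T i).card_arcs_le
    rw [Fintype.card_fin] at h3
    have hX : 0 ≤ ∑ a ∈ (T i).arcs, (transRatio (T i) a.1 a.2 - 1 / 4) ^ 2 := by positivity
    rw [div_pow, div_le_div_iff₀ (by positivity) (by positivity)]
    have h4 := h2.trans (mul_le_mul_of_nonneg_right h3 hX)
    nlinarith [mul_le_mul_of_nonneg_right h4 (sq_nonneg (N i : ℝ))]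

theorem tendsto_sum_abs_codeg (hN : Tendsto N atTop atTop)
    (h : Tendsto (fun i => (∑ a ∈ (T i).arcs, |transRatio (T i) a.1 a.2 - 1 / 4|) / (N i : ℝ) ^ 2)
      atTop (𝓝 0)) :
    Tendsto (fun i => (∑ u, ∑ v, |(T i).codeg u v|) / (N i : ℝ) ^ 3) atTop (𝓝 0) := by
  have hN' : Tendsto (fun i => (N i : ℝ)) atTop atTop := tendsto_natCast_atTop_atTop.comp hN
  have hinv := hN'.inv_tendsto_atTop
  set δ : ℕ → ℝ := fun i =>
    (∑ a ∈ (T i).arcs, |transRatio (T i) a.1 a.2 - 1 / 4|) / (N i : ℝ) ^ 2 with hδ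
  have h1 : Tendsto (fun i => 4 * √(8 * δ i + (N i : ℝ)⁻¹) + 8 * δ i + 5 * (N i : ℝ)⁻¹) atTop
      (𝓝 0) := by
    have h2 := (Real.continuous_sqrt.tendsto _).comp ((h.const_mul 8).add hinv)
    simpa using ((h2.const_mul 4).add (h.const_mul 8)).add (hinv.const_mul 5)
  refine squeeze_zero' (Eventually.of_forall fun i => by positivity) ?_ h1
  filter_upwards [hN.eventually_ge_atTop 3] with i hi
  have h3 := sum_abs_codeg_le (T i) hi
  have hn : (0 : ℝ) < N i := by
    have : (3 : ℝ) ≤ N i := by exact_mod_cast hi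
    linarith
  have h4 : ∑ a ∈ (T i).arcs, |transRatio (T i) a.1 a.2 - 1 / 4| = δ i * (N i : ℝ) ^ 2 := by
    rw [hδ, div_mul_cancel₀ _ (by positivity)]
  rw [h4] at h3
  generalize δ i = d at *
  generalize (N i : ℝ) = n at *
  have h5 : n * (8 * n * (d * n ^ 2) + n ^ 2) = (n ^ 2) ^ 2 * (8 * d + n⁻¹) := by
    field_simp
  rw [h5, Real.sqrt_mul (by positivity), Real.sqrt_sq (by positivity)] at h3
  rw [div_le_iff₀ (by positivity)]
  refine h3.trans (le_of_eq ?_)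
  field_simp

/-- The counting estimate gives every labelled `H` the same limiting proportion `c`, independently
of its arcs. -/
theorem isQuasiRandom_of_tendsto_codeg (hN : Tendsto N atTop atTop)
    (h : Tendsto (fun i => (∑ u, ∑ v, |(T i).codeg u v|) / (N i : ℝ) ^ 3) atTop (𝓝 0)) :
    IsQuasiRandom T := by
  rw [isQuasiRandom_iff_tendsto_placement T hN]
  intro m
  have hE := tendsto_card_embedding_div hN m
  set c : ℝ := 1 / 2 ^ #(Tournament.increasingPairs m) with hc
  have hne : ∀ᶠ i in atTop, (Fintype.card (Fin m ↪ Fin (N i)) : ℝ) ≠ 0 := by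
    filter_upwards [hN.eventually_ge_atTop m] with i hi
    have : Nonempty (Fin m ↪ Fin (N i)) := ⟨Fin.castLEEmb hi⟩
    exact_mod_cast Fintype.card_ne_zero
  have h1 : ∀ H : Tournament (Fin m), Tendsto (fun i =>
      (Fintype.card ((T i).Placement H) : ℝ) / Fintype.card (Fin m ↪ Fin (N i))) atTop (𝓝 c) := by
    intro H
    have h2 : Tendsto (fun i => (1 - (Fintype.card (Fin m ↪ Fin (N i)) : ℝ) / (N i : ℝ) ^ m) +
        #(Tournament.increasingPairs m) * √((∑ u, ∑ v, |(T i).codeg u v|) / (N i : ℝ) ^ 3)) atTop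
        (𝓝 0) := by
      have h3 := (Real.continuous_sqrt.tendsto _).comp h
      simpa using (hE.const_sub 1).add (h3.const_mul (#(Tournament.increasingPairs m) : ℝ))
    have h4 : Tendsto (fun i => (Fintype.card ((T i).Placement H) : ℝ) / (N i : ℝ) ^ m) atTop
        (𝓝 c) := by
      rw [tendsto_iff_norm_sub_tendsto_zero]
      refine squeeze_zero' (Eventually.of_forall fun _ => norm_nonneg _) ?_ h2
      filter_upwards [hN.eventually_gt_atTop 0] with i hi
      have h5 := (T i).abs_card_placement_sub_le H
      rw [Fintype.card_fin] at h5
      have hn : (0 : ℝ) < N i := by exact_mod_cast hi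
      have hK : 0 ≤ ∑ u, ∑ v, |(T i).codeg u v| := by positivity
      generalize ∑ u, ∑ v, |(T i).codeg u v| = K at *
      generalize (Fintype.card ((T i).Placement H) : ℝ) = p at *
      generalize (Fintype.card (Fin m ↪ Fin (N i)) : ℝ) = q at *
      generalize (N i : ℝ) = n at *
      have hnm : 0 < n ^ m := by positivity
      have e1 : n * K = (n ^ 2) ^ 2 * (K / n ^ 3) := by field_simp
      rw [e1, Real.sqrt_mul (by positivity), Real.sqrt_sq (by positivity)] at h5
      have e2 : p / n ^ m - c = (p - n ^ m / 2 ^ #(Tournament.increasingPairs m)) / n ^ m := by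
        rw [hc, sub_div]
        field_simp
      rw [Real.norm_eq_abs, e2, abs_div, abs_of_pos hnm, div_le_iff₀ hnm]
      refine le_of_mul_le_mul_left (h5.trans (le_of_eq ?_)) (by positivity : 0 < n ^ 2)
      field_simp
    have h5 := h4.div hE one_ne_zero
    rw [div_one] at h5
    refine h5.congr' ?_
    filter_upwards [hN.eventually_gt_atTop 0] with i hi
    have hn : (N i : ℝ) ^ m ≠ 0 := by positivity
    exact div_div_div_cancel_right₀ hn _ _
  -- The proportions over all `H` add up to `1`, which forces `c` to be the reciprocal of the number
  -- of tournaments without counting them.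
  have h2 := tendsto_finsetSum univ fun (H : Tournament (Fin m)) (_ : H ∈ univ) => h1 H
  have h3 : Tendsto (fun i => ∑ H : Tournament (Fin m),
      (Fintype.card ((T i).Placement H) : ℝ) / Fintype.card (Fin m ↪ Fin (N i))) atTop (𝓝 1) := by
    refine tendsto_const_nhds.congr' ?_
    filter_upwards [hne] with i hi
    have h4 := (T i).sum_embedding_eq (m := m) fun _ => 1
    simp only [sum_const, card_univ, nsmul_eq_mul, mul_one] at h4
    rw [← sum_div, ← h4, div_self hi]
  have h4 := tendsto_nhds_unique h2 h3
  rw [sum_const, card_univ, nsmul_eq_mul] at h4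
  have h5 : 1 / (Fintype.card (Tournament (Fin m)) : ℝ) = c := by
    have : (Fintype.card (Tournament (Fin m)) : ℝ) ≠ 0 := by exact_mod_cast Fintype.card_ne_zero
    field_simp
    linarith
  rw [h5]
  exact h1

theorem isQuasiRandom_iff_tendsto_sum_sq (hN : Tendsto N atTop atTop) :
    IsQuasiRandom T ↔ Tendsto (fun i =>
      (∑ a ∈ (T i).arcs, (transRatio (T i) a.1 a.2 - 1 / 4) ^ 2) / (N i : ℝ) ^ 2)
      atTop (𝓝 0) :=
  ⟨fun h => h.tendsto_sum_sq hN, fun h => isQuasiRandom_of_tendsto_codeg hN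
    (tendsto_sum_abs_codeg hN ((tendsto_sum_abs_iff_sum_sq hN).2 h))⟩

/-- The second moment vanishes along a convergent sequence iff the sequence is quasi-random. -/
theorem isQuasiRandom_iff_of_tendsto_average (hN : Tendsto N atTop atTop) {L : ℝ}
    (hL : Tendsto (fun i : ℕ => (∑ θ : (T i).Placement arcType,
      (transRatio (T i) (θ.1 0) (θ.1 1) - 1 / 4) ^ 2 : ℝ) /
        (Fintype.card ((T i).Placement arcType) : ℝ)) atTop (𝓝 L)) :
    IsQuasiRandom T ↔ L = 0 := by
  have hinv := (tendsto_natCast_atTop_atTop (R := ℝ)).comp hN |>.inv_tendsto_atTop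
  -- This is the number of arcs over `n²`, converting averages over arcs to the normalisation by
  -- `n²`.
  have h1 : Tendsto (fun i => (1 - (N i : ℝ)⁻¹) / 2) atTop (𝓝 (1 / 2)) := by
    simpa using (hinv.const_sub 1).div_const 2
  have h2 : Tendsto (fun i =>
      (∑ a ∈ (T i).arcs, (transRatio (T i) a.1 a.2 - 1 / 4) ^ 2) / (N i : ℝ) ^ 2)
      atTop (𝓝 (L * (1 / 2))) := by
    refine (hL.mul h1).congr' ?_
    filter_upwards [hN.eventually_ge_atTop 2] with i hi
    have hn : (2 : ℝ) ≤ N i := by exact_mod_cast hi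
    have hc := (T i).two_mul_card_arcs
    rw [Fintype.card_fin] at hc
    rw [(T i).sum_placement_arcType fun u v => (transRatio (T i) u v - 1 / 4) ^ 2,
      (T i).card_placement_arcType]
    have hc' : (#(T i).arcs : ℝ) = N i * (N i - 1) / 2 := by linarith
    rw [hc']
    have h3 : (N i : ℝ) - 1 ≠ 0 := by linarith
    have h4 : (N i : ℝ) ≠ 0 := by linarith
    generalize ∑ a ∈ (T i).arcs, (transRatio (T i) a.1 a.2 - 1 / 4) ^ 2 = X
    field_simp
  rw [isQuasiRandom_iff_tendsto_sum_sq hN]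
  constructor
  · intro h
    have := tendsto_nhds_unique h h2
    linarith
  · rintro rfl
    simpa using h2

end Sequences

/-! ### Conclusion. -/

theorem isQuasiRandom_iff_eq_phiRdm {φ : PosHom emptyType} {N : ℕ → ℕ}
    {T : ∀ i, Tournament (Fin (N i))}
    (hT : ∀ (m : ℕ) (F : TFlag emptyType (Fin m)),
      Tendsto (fun i => F.density (TFlag.ofTournament (T i))) atTop (𝓝 (φ.eval F))) :
    IsQuasiRandom T ↔ φ = phiRdm := by
  constructor
  · intro h
    refine PosHom.ext (funext fun m => funext fun F => ?_)
    rw [← φ.eval_out, ← phiRdm.eval_out, ← TFlag.ofTournament_model F.out]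
    exact tendsto_nhds_unique (hT m _) (h m _)
  · rintro rfl m H
    exact hT m _

theorem theorem2 :
    (∀ φ : PosHom emptyType,
      (∃ P : ProbabilityMeasure (PosHom arcType), IsExtension φ P) ∧
      ∀ P : ProbabilityMeasure (PosHom arcType), IsExtension φ P →
        ((∀ᵐ ψ ∂(P : Measure (PosHom arcType)), ψ.eval trA = 1 / 4) ↔ φ = phiRdm)) ∧
    (∀ (N : ℕ → ℕ) (T : ∀ i, Tournament (Fin (N i))), Tendsto N atTop atTop →
      (IsQuasiRandom T ↔
        (fun i => ∑ a : Fin (N i) × Fin (N i) with (T i).Adj a.1 a.2,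
          |transRatio (T i) a.1 a.2 - 1 / 4|) =o[atTop] fun i => (N i : ℝ) ^ 2)) := by
  refine ⟨fun φ => ?_, fun N T hN => ?_⟩
  · obtain ⟨N, T, hNi, hT⟩ := φ.exists_tendsto_density
    have hN : Tendsto N atTop atTop :=
      tendsto_atTop_mono (fun i => (Nat.le_add_right i 2).trans (hNi i)) tendsto_id
    have hne : ∀ i, Nonempty ((T i).Placement arcType) := by
      intro i
      have h2 := hNi i
      rcases (T i).adj_trichotomy ⟨0, by omega⟩ ⟨1, by omega⟩ with h | h | h
      · simp at h
      · obtain ⟨θ, -⟩ := (T i).exists_placement h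
        exact ⟨θ⟩
      · obtain ⟨θ, -⟩ := (T i).exists_placement h
        exact ⟨θ⟩
    refine ⟨φ.exists_isExtension φ.evalDown_unit_arcType_ne_zero hN hT hne, fun P hP => ?_⟩
    rw [PosHom.ae_eval_trA_eq_iff, ← isQuasiRandom_iff_eq_phiRdm hT]
    exact (isQuasiRandom_iff_of_tendsto_average hN
      (φ.tendsto_average_sq_transRatio hP hN hT hne)).symm
  · rw [isLittleO_iff_tendsto', isQuasiRandom_iff_tendsto_sum_sq hN,
      ← tendsto_sum_abs_iff_sum_sq hN]
    · rfl
    -- The side condition about a vanishing `n²` is eventually vacuous.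
    · filter_upwards [hN.eventually_gt_atTop 0] with i hi h
      have : (0 : ℝ) < (N i : ℝ) ^ 2 := by positivity
      exact absurd h this.ne'
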